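/- Let $n\ge 2$ be an integer, $k\in\{1,\dots,n-1\}$ and $k/2\le\alpha<k$. Let $\widehat f(\xi)=(2\pi)^{-n/2}\int_{\mathbb R^n}e^{-i\xi\cdot x}f(x)\,dx$ denote the Fourier transform, let $\|f\|_{\dot H^s(\mathbb R^n)}=\big(\int_{\mathbb R^n}|\xi|^{2s}|\widehat f(\xi)|^2\,d\xi\big)^{1/2}$ for $s\in\mathbb R$, let $\mu$ be the normalized Haar measure on $SO(n)$, let $e_1,\dots,e_n$ be the standard basis of $\mathbb R^n$, and let $B_R=\{x\in\mathbb R^n:|x|<R\}$. For $f\in\mathcal S(\mathbb R^n)$ let $$I_\alpha f(x,Q)=\frac1{(2\pi)^{n/2}}\int_{\mathbb R^n}e^{ix\cdot\xi}\,\frac{\widehat f(\xi)}{|(Qe_1\cdot\xi)^2+\dots+(Qe_k\cdot\xi)^2|^{\alpha/2}}\,d\xi,\qquad (x,Q)\in\mathbb R^n\times SO(n),$$ be the $k$-plane Riesz potential, and let $(-\Delta)^{\alpha/2}$ be the fractional Laplacian in $\mathbb R^n$, i.e. the operator that multiplies the Fourier transform (of a tempered distribution whose Fourier transform is a function) by $|\xi|^\alpha$.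 Put $\mathfrak g(t)=\log t$ if $\alpha=k/2$ and $\mathfrak g(t)=t^{2\alpha-k}$ if $\alpha>k/2$. Then there are a constant $c>0$ and, for every $s\in\mathbb R$, constants $A_s,B_s>0$, all depending only on $n,k,\alpha$ (and $A_s,B_s$ also on $s$), such that for every $R>0$ there is a sequence of functions $f_N\in\mathcal S(\mathbb R^n)$ with $$A_sN^s\le\|f_N\|_{\dot H^s(\mathbb R^n)}\le B_sN^s\qquad\text{for all integers } N\ge1\text{ and all } s\in\mathbb R,$$ and $$\int_{SO(n)}\big\|(-\Delta)^{\alpha/2}I_\alpha f_N(\cdot,Q)\big\|_{L^2(B_R)}^2\,d\mu(Q)\ \ge\ c\,\mathfrak g(RN)\qquad\text{for all integers } N>\frac{\pi}{2R}.$$ -/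

import Mathlib

open MeasureTheory
open scoped SchwartzMap

noncomputable section

namespace RotSmooth

/-- The Euclidean space `ℝⁿ`. -/
abbrev E (n : ℕ) : Type := EuclideanSpace ℝ (Fin n)

/-- The special orthogonal group `SO(n)` of real `n × n` matrices. -/
abbrev SO (n : ℕ) : Type := Matrix.specialOrthogonalGroup (Fin n) ℝ

/-! ### The normalized Haar measure on `SO(n)` -/

theorem SO.mul_transpose {n : ℕ} (Q : SO n) : Q.1 * Q.1.transpose = 1 :=
  Q.2.1.2

theorem SO.coe_inv {n : ℕ} (Q : SO n) : (Q⁻¹).1 = Q.1.transpose := rfl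

/-- `SO(n)` carries the topology induced from the space of all `n × n` matrices, and it is a
topological group. -/
instance SO.instIsTopologicalGroup (n : ℕ) : IsTopologicalGroup (SO n) where
  continuous_inv := by
    refine Continuous.subtype_mk ?_ _
    exact Continuous.matrix_transpose continuous_subtype_val

theorem SO.abs_entry_le_one {n : ℕ} (Q : SO n) (i j : Fin n) : |Q.1 i j| ≤ 1 := by
  have h := congrFun (congrFun (SO.mul_transpose Q) i) i
  rw [Matrix.mul_apply, Matrix.one_apply_eq] at h
  simp only [Matrix.transpose_apply] at h
  have h2 : Q.1 i j * Q.1 i j ≤ ∑ l, Q.1 i l * Q.1 i l :=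
    Finset.single_le_sum (f := fun l => Q.1 i l * Q.1 i l)
      (fun l _ => mul_self_nonneg _) (Finset.mem_univ j)
  exact abs_le_one_iff_mul_self_le_one.mpr (h2.trans h.le)

theorem SO.mem_iff {n : ℕ} (A : Matrix (Fin n) (Fin n) ℝ) :
    A ∈ Matrix.specialOrthogonalGroup (Fin n) ℝ ↔
      A.transpose * A = 1 ∧ A.det = 1 := by
  rw [Matrix.mem_specialOrthogonalGroup_iff]
  exact and_congr_left' (Matrix.mem_orthogonalGroup_iff' (Fin n) ℝ)

instance SO.instCompactSpace (n : ℕ) : CompactSpace (SO n) := by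
  have hbox : IsCompact (Set.pi Set.univ fun _ : Fin n =>
      Set.pi Set.univ fun _ : Fin n => Set.Icc (-1 : ℝ) 1) :=
    isCompact_univ_pi fun _ => isCompact_univ_pi fun _ => isCompact_Icc
  have hclosed : IsClosed {A : Matrix (Fin n) (Fin n) ℝ |
      A ∈ Matrix.specialOrthogonalGroup (Fin n) ℝ} := by
    simp only [SO.mem_iff, Set.ofPred_and]
    exact (isClosed_eq (by fun_prop) continuous_const).inter
      (isClosed_eq (by fun_prop) continuous_const)
  exact isCompact_iff_compactSpace.mp (hbox.of_isClosed_subset hclosed fun A hA => by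
    simp only [Set.mem_pi, Set.mem_univ, true_imp_iff, Set.mem_Icc]
    exact fun i j => abs_le.mp (SO.abs_entry_le_one ⟨A, hA⟩ i j))

/-- The Borel σ-algebra of `SO(n)`. -/
instance SO.instMeasurableSpace (n : ℕ) : MeasurableSpace (SO n) := borel _

instance SO.instBorelSpace (n : ℕ) : BorelSpace (SO n) := ⟨rfl⟩

/-- The normalized Haar measure on `SO(n)`: the left-invariant measure of total mass `1`. -/
def haarSO (n : ℕ) : Measure (SO n) := Measure.haarMeasure ⊤

/-! ### Fourier transform, homogeneous Sobolev norms -/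

/-- The Fourier transform with unitary normalization,
`(2π)^{-n/2} ∫ e^{-i ξ·x} f(x) dx`. -/
def ft {n : ℕ} (f : E n → ℂ) (ξ : E n) : ℂ :=
  (((2 * Real.pi) ^ (-(n : ℝ) / 2) : ℝ) : ℂ) *
    ∫ x : E n, Complex.exp (-(Complex.I * ((inner ℝ ξ x : ℝ) : ℂ))) * f x

/-- The homogeneous Sobolev norm `(∫ |ξ|^{2s} |f̂(ξ)|² dξ)^{1/2}` (possibly infinite) of a
Schwartz function. -/
def hDotNorm {n : ℕ} (s : ℝ) (f : 𝓢(E n, ℂ)) : ENNReal :=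
  (∫⁻ ξ : E n, ENNReal.ofReal (‖ξ‖ ^ (2 * s) * ‖ft f ξ‖ ^ 2)) ^ (1 / 2 : ℝ)

/-! ### The Riesz potential along `k`-dimensional vector subspaces -/

/-- The vector `Q e_j ∈ ℝⁿ`. -/
def rotE {n : ℕ} (Q : SO n) (j : Fin n) : E n :=
  WithLp.toLp 2 (Q.1.mulVec (Pi.single j 1))

/-- The symbol `|(Q e₁·ξ)² + ⋯ + (Q e_k·ξ)²|^{α/2}` (the coordinates are numbered
`0, …, n - 1` here). -/
def symb {n : ℕ} (k : ℕ) (α : ℝ) (ξ : E n) (Q : SO n) : ℝ :=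
  |∑ j : Fin n with j.val < k, (inner ℝ (rotE Q j) ξ : ℝ) ^ 2| ^ (α / 2)

/-- The `k`-plane Riesz potential
`I_α f(x, Q) = (2π)^{-n/2} ∫ e^{i x·ξ} f̂(ξ) / |(Q e₁·ξ)² + ⋯ + (Q e_k·ξ)²|^{α/2} dξ`. -/
def rieszPot {n : ℕ} (k : ℕ) (α : ℝ) (f : 𝓢(E n, ℂ)) (x : E n) (Q : SO n) : ℂ :=
  (((2 * Real.pi) ^ (-(n : ℝ) / 2) : ℝ) : ℂ) *
    ∫ ξ : E n, Complex.exp (Complex.I * ((inner ℝ x ξ : ℝ) : ℂ)) *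
      (ft f ξ / (symb k α ξ Q : ℂ))

/-! ### The fractional Laplacian -/

/-- The functions `u` and `U` define tempered distributions (by absolutely convergent integrals)
and `U` is the Fourier transform of `u` in the sense of tempered distributions. -/
def IsFourierTransform {n : ℕ} (u U : E n → ℂ) : Prop :=
  (∀ φ : 𝓢(E n, ℂ), Integrable (fun x => u x * φ x)) ∧
  (∀ φ : 𝓢(E n, ℂ), Integrable (fun ξ => U ξ * φ ξ)) ∧
  ∀ φ : 𝓢(E n, ℂ), ∫ ξ, U ξ * φ ξ = ∫ x, u x * ft φ x

/-- `v = (-Δ)^{a/2} u`, that is, `v̂ = |ξ|^a û` (in the sense of tempered distributions, for `u`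
and `v` whose Fourier transforms are functions). The function `v` is determined by `u` up to a
null set. -/
def IsFracLaplacian {n : ℕ} (a : ℝ) (u v : E n → ℂ) : Prop :=
  ∃ U : E n → ℂ, IsFourierTransform u U ∧
    IsFourierTransform v (fun ξ => ((‖ξ‖ ^ a : ℝ) : ℂ) * U ξ)

open Classical in
/-- The fractional Laplacian `(-Δ)^{a/2} u` in `ℝⁿ` (determined up to a null set), and `0` if it
does not exist as a function. -/
def fracLaplacian {n : ℕ} (a : ℝ) (u : E n → ℂ) : E n → ℂ :=
  if h : ∃ v : E n → ℂ, IsFracLaplacian a u v then h.choose else 0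

/-! ### The localized average and the growth function -/

/-- `∫_{SO(n)} ‖(-Δ)^{α/2} I_α f(·, Q)‖²_{L²(B_R)} dμ(Q)`, with `B_R = {x : |x| < R}`. -/
def localAverage {n : ℕ} (k : ℕ) (α R : ℝ) (f : 𝓢(E n, ℂ)) : ENNReal :=
  ∫⁻ Q : SO n, (eLpNorm (fracLaplacian α (fun x => rieszPot k α f x Q)) 2
    (volume.restrict (Metric.ball 0 R))) ^ 2 ∂(haarSO n)

/-- The growth function: `log t` if `α = k/2`, and `t^{2α-k}` otherwise. -/
def growth (k : ℕ) (α t : ℝ) : ℝ :=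
  open Classical in if α = (k : ℝ) / 2 then Real.log t else t ^ (2 * α - k)

end RotSmooth

end

/-! Take `f_N` with Fourier transform `N^{-n/2} χ(ξ/N)`, where `χ` is a fixed smooth radial bump on
an annulus. Scaling gives its `Ḣ^s` norm as exactly a constant times `N^s` (`hDotNorm_eq`), and the
same sequence serves every `R`.

The multiplier `|ξ|^α / |ξ'|^α`, with `ξ'` the first `k` coordinates, is homogeneous of degree `0`,
and `χ` is radial. Hence `(-Δ)^{α/2} I_α f_N(x, Q) = N^{n/2} v(N Q⁻¹ x)` a.e., where `v` is the
inverse transform of `|ξ|^α χ(ξ) / |ξ'|^α`. Both `Q` and `N` can be scaled away: the average over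
`SO(n)` equals `‖v‖²_{L²(B_{RN})}` (`sq_eLpNorm_fracLaplacian_rieszPot`).

The singularity of the multiplier on `ξ' = 0` makes `v` decay slowly in the first `k` variables.
This is quantified by duality, without asymptotics of `v`. Let `Φ ≥ 0` be supported in the unit ball
with nonnegative Fourier transform, and stretch it to `Φ(x'/r, x'')`. On the frequency side the
stretching compresses `ξ'` by `r`, so the pairing with `v` is at least `c r^α`
(`exists_pairing_lower_bound`), while the squared `L²` norm of the stretched function is at most `K
r^k`. Cauchy–Schwarz with `r = ρ` gives `‖v‖²_{L²(B_ρ)} ≥ c ρ^{2α-k}`.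

At `α = k/2` every single scale contributes only a constant. There the test functions at the scales
`4^i ≤ ρ`, weighted by `4^{-ik/2}`, are almost orthogonal, and the roughly `log ρ` contributions add
up (`exists_superposition_bound`, `exists_growth_le_eLpNorm`). -/

noncomputable section

namespace RotSmooth

open scoped FourierTransform
open Real (pi_pos)

/-! ### The inverse Fourier transform with unitary normalization -/

/-- The inverse Fourier transform `(2π)^{-n/2} ∫ e^{i x·ξ} U(ξ) dξ`. -/
def invFt {n : ℕ} (U : E n → ℂ) (x : E n) : ℂ :=
  (((2 * Real.pi) ^ (-(n : ℝ) / 2) : ℝ) : ℂ) *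
    ∫ ξ : E n, Complex.exp (Complex.I * ((inner ℝ x ξ : ℝ) : ℂ)) * U ξ

theorem unitaryConst_pos (n : ℕ) : 0 < (2 * Real.pi) ^ (-(n : ℝ) / 2) := by
  have := pi_pos
  positivity

theorem unitaryConst_sq (n : ℕ) :
    (2 * Real.pi) ^ (-(n : ℝ) / 2) * (2 * Real.pi) ^ (-(n : ℝ) / 2) * (2 * Real.pi) ^ n = 1 := by
  have h : (0 : ℝ) < 2 * Real.pi := by have := pi_pos; positivity
  rw [← Real.rpow_natCast, ← Real.rpow_add h, ← Real.rpow_add h]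
  ring_nf
  simp

theorem norm_exp_I_mul_ofReal (t : ℝ) : ‖Complex.exp (Complex.I * (t : ℂ))‖ = 1 := by
  rw [mul_comm, Complex.norm_exp_ofReal_mul_I]

theorem ft_eq_fourier {n : ℕ} (f : E n → ℂ) (ξ : E n) :
    ft f ξ = (((2 * Real.pi) ^ (-(n : ℝ) / 2) : ℝ) : ℂ) * 𝓕 f ((2 * Real.pi)⁻¹ • ξ) := by
  rw [ft, Real.fourier_eq']
  congr 1
  refine integral_congr_ae (Filter.Eventually.of_forall fun x => ?_)
  simp only [smul_eq_mul]
  congr 2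
  have h : (2 * Real.pi) ≠ 0 := by have := pi_pos; positivity
  rw [inner_smul_right, show -2 * Real.pi * ((2 * Real.pi)⁻¹ * inner ℝ x ξ) = -inner ℝ ξ x by
    rw [real_inner_comm]; field_simp]
  push_cast
  ring

theorem invFt_ft {n : ℕ} (φ : 𝓢(E n, ℂ)) (x : E n) : invFt (ft φ) x = φ x := by
  have h2 : (0 : ℝ) < 2 * Real.pi := by have := pi_pos; positivity
  have hinv : 𝓕⁻ (𝓕 (φ : E n → ℂ)) x = φ x := by
    rw [← SchwartzMap.fourier_coe, ← SchwartzMap.fourierInv_coe, FourierTransform.fourierInv_fourier_eq]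
  rw [Real.fourierInv_eq'] at hinv
  rw [invFt]
  obtain ⟨F, hF⟩ : ∃ F : E n → ℂ, F = fun v : E n =>
      Complex.exp ((↑(2 * Real.pi * (inner ℝ v x : ℝ)) * Complex.I)) • 𝓕 (φ : E n → ℂ) v :=
    ⟨_, rfl⟩
  have h1 : ∀ ξ : E n, Complex.exp (Complex.I * ((inner ℝ x ξ : ℝ) : ℂ)) * ft φ ξ =
      (((2 * Real.pi) ^ (-(n : ℝ) / 2) : ℝ) : ℂ) * F ((2 * Real.pi)⁻¹ • ξ) := by
    intro ξ
    rw [ft_eq_fourier, hF]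
    simp only [smul_eq_mul]
    rw [inner_smul_left, real_inner_comm]
    simp only [map_inv₀, conj_trivial]
    rw [show 2 * Real.pi * ((2 * Real.pi)⁻¹ * inner ℝ ξ x) = inner ℝ ξ x by field_simp]
    rw [mul_comm Complex.I]
    ring
  rw [integral_congr_ae (Filter.Eventually.of_forall h1), integral_const_mul, Measure.integral_comp_inv_smul_of_nonneg _ _ h2.le, hF, hinv,
    finrank_euclideanSpace_fin, Complex.real_smul, ← mul_assoc, ← mul_assoc, ← Complex.ofReal_mul,
    ← Complex.ofReal_mul, unitaryConst_sq, Complex.ofReal_one, one_mul]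

/-- Dilation by a nonzero factor as a continuous linear equivalence. -/
def dilation {n : ℕ} (t : ℝ) (ht : t ≠ 0) : E n ≃L[ℝ] E n :=
  ContinuousLinearEquiv.smulLeft (Units.mk0 t ht)

@[simp] theorem dilation_apply {n : ℕ} (t : ℝ) (ht : t ≠ 0) (x : E n) :
    dilation t ht x = t • x := rfl

theorem two_pi_ne_zero : 2 * Real.pi ≠ 0 := by have := pi_pos; positivity

/-- `IsFourierTransform` tests `u` against the bare function `ft φ`; this realizes that function as
a Schwartz function, so that it is integrable. -/
theorem exists_schwartz_eq_ft {n : ℕ} (φ : 𝓢(E n, ℂ)) : ∃ ψ : 𝓢(E n, ℂ), ∀ ξ, ψ ξ = ft φ ξ := by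
  refine ⟨(((2 * Real.pi) ^ (-(n : ℝ) / 2) : ℝ) : ℂ) •
    SchwartzMap.compCLMOfContinuousLinearEquiv ℂ (dilation _ (inv_ne_zero two_pi_ne_zero)) (𝓕 φ), ?_⟩
  intro ξ
  rw [ft_eq_fourier]
  simp [SchwartzMap.fourier_coe]

/-- Surjectivity serves twice: it makes `ft φ` range over all test functions in the uniqueness
argument, and it produces the functions `f_N` from their transforms. -/
theorem exists_ft_eq_schwartz {n : ℕ} (ψ : 𝓢(E n, ℂ)) : ∃ φ : 𝓢(E n, ℂ), ∀ ξ, ft φ ξ = ψ ξ := by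
  refine ⟨𝓕⁻ (((((2 * Real.pi) ^ (-(n : ℝ) / 2) : ℝ) : ℂ)⁻¹) •
    SchwartzMap.compCLMOfContinuousLinearEquiv ℂ (dilation _ two_pi_ne_zero) ψ), ?_⟩
  intro ξ
  have hc : (((2 * Real.pi) ^ (-(n : ℝ) / 2) : ℝ) : ℂ) ≠ 0 := by
    exact_mod_cast (unitaryConst_pos n).ne'
  rw [ft_eq_fourier, ← SchwartzMap.fourier_coe, FourierTransform.fourier_fourierInv_eq]
  simp only [smul_apply, SchwartzMap.compCLMOfContinuousLinearEquiv_apply,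
    Function.comp_apply, dilation_apply, smul_eq_mul]
  rw [mul_inv_cancel_left₀ hc, smul_smul, mul_inv_cancel₀ two_pi_ne_zero, one_smul]

theorem continuous_invFt {n : ℕ} {U : E n → ℂ} (hU : Integrable U) : Continuous (invFt U) := by
  refine continuous_const.mul ?_
  refine continuous_of_dominated (bound := fun ξ => ‖U ξ‖) ?_ ?_ hU.norm ?_
  · intro x
    exact (by fun_prop : Continuous fun ξ : E n =>
      Complex.exp (Complex.I * ((inner ℝ x ξ : ℝ) : ℂ))).aestronglyMeasurable.mul hU.1
  · intro x
    refine Filter.Eventually.of_forall fun ξ => ?_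
    rw [norm_mul, norm_exp_I_mul_ofReal, one_mul]
  · refine Filter.Eventually.of_forall fun ξ => ?_
    fun_prop

theorem norm_invFt_le {n : ℕ} (U : E n → ℂ) (x : E n) :
    ‖invFt U x‖ ≤ (2 * Real.pi) ^ (-(n : ℝ) / 2) * ∫ ξ, ‖U ξ‖ := by
  rw [invFt, norm_mul, Complex.norm_real, Real.norm_of_nonneg (unitaryConst_pos n).le]
  refine mul_le_mul_of_nonneg_left ?_ (unitaryConst_pos n).le
  refine (norm_integral_le_integral_norm _).trans_eq ?_
  refine integral_congr_ae (Filter.Eventually.of_forall fun ξ => ?_)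
  simp only [norm_mul, norm_exp_I_mul_ofReal, one_mul]

/-- The multiplication formula for the inverse Fourier transform. -/
theorem integral_invFt_mul {n : ℕ} {U h : E n → ℂ} (hU : Integrable U) (hh : Integrable h) :
    ∫ x, invFt U x * h x = ∫ ξ, U ξ * invFt h ξ := by
  have hint : Integrable (Function.uncurry fun (x ξ : E n) =>
      Complex.exp (Complex.I * ((inner ℝ x ξ : ℝ) : ℂ)) * (h x * U ξ))
      ((volume : Measure (E n)).prod volume) := by
    refine (hh.mul_prod hU).bdd_mul (c := 1) ?_ ?_
    · exact (by fun_prop : Continuous fun p : E n × E n =>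
        Complex.exp (Complex.I * ((inner ℝ p.1 p.2 : ℝ) : ℂ))).aestronglyMeasurable
    · exact Filter.Eventually.of_forall fun p => (norm_exp_I_mul_ofReal _).le
  have := integral_integral_swap hint
  calc ∫ x, invFt U x * h x
      = (((2 * Real.pi) ^ (-(n : ℝ) / 2) : ℝ) : ℂ) * ∫ x, ∫ ξ,
          Complex.exp (Complex.I * ((inner ℝ x ξ : ℝ) : ℂ)) * (h x * U ξ) := by
        rw [← integral_const_mul]
        refine integral_congr_ae (Filter.Eventually.of_forall fun x => ?_)
        simp only [invFt]
        rw [mul_assoc, ← integral_mul_const]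
        congr 1
        apply integral_congr_ae
        filter_upwards with ξ
        ring
    _ = (((2 * Real.pi) ^ (-(n : ℝ) / 2) : ℝ) : ℂ) * ∫ ξ, ∫ x,
          Complex.exp (Complex.I * ((inner ℝ x ξ : ℝ) : ℂ)) * (h x * U ξ) := by rw [this]
    _ = ∫ ξ, U ξ * invFt h ξ := by
        rw [← integral_const_mul]
        refine integral_congr_ae (Filter.Eventually.of_forall fun ξ => ?_)
        simp only [invFt]
        rw [mul_left_comm (U ξ)]
        congr 1
        rw [← integral_const_mul]
        apply integral_congr_ae
        filter_upwards with x
        rw [real_inner_comm]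
        ring

theorem integrable_mul_schwartz {n : ℕ} {U : E n → ℂ} (hU : Integrable U) (φ : 𝓢(E n, ℂ)) :
    Integrable fun ξ => U ξ * φ ξ := by
  exact hU.mul_bdd (c := ‖φ.toBoundedContinuousFunction‖) φ.continuous.aestronglyMeasurable
    (Filter.Eventually.of_forall fun ξ => φ.toBoundedContinuousFunction.norm_coe_le_norm ξ)

theorem isFourierTransform_invFt {n : ℕ} {U : E n → ℂ} (hU : Integrable U) :
    IsFourierTransform (invFt U) U := by
  refine ⟨fun φ => ?_, integrable_mul_schwartz hU, fun φ => ?_⟩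
  · exact φ.integrable.bdd_mul (continuous_invFt hU).aestronglyMeasurable
      (Filter.Eventually.of_forall fun x => norm_invFt_le U x)
  · obtain ⟨ψ, hψ⟩ := exists_schwartz_eq_ft φ
    have hψ' : (ψ : E n → ℂ) = ft φ := funext hψ
    rw [← hψ', integral_invFt_mul hU ψ.integrable, hψ']
    simp only [invFt_ft]

/-! ### Uniqueness of distributional Fourier transforms -/

open scoped ContDiff in
theorem exists_schwartz_ofReal {n : ℕ} {g : E n → ℝ} (hg : ContDiff ℝ ∞ g)
    (hs : HasCompactSupport g) : ∃ φ : 𝓢(E n, ℂ), ∀ x, φ x = (g x : ℂ) :=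
  ⟨(hs.comp_left Complex.ofReal_zero).toSchwartzMap (Complex.ofRealCLM.contDiff.comp hg),
    fun _ => rfl⟩

/-- Testing with a bump equal to `1` near a point shows integrability near that point. -/
theorem locallyIntegrable_of_integrable_mul_schwartz {n : ℕ} {u : E n → ℂ}
    (hu : ∀ φ : 𝓢(E n, ℂ), Integrable fun x => u x * φ x) : LocallyIntegrable u := by
  intro x
  let b : ContDiffBump x := ⟨1, 2, one_pos, one_lt_two⟩
  obtain ⟨φ, hφ⟩ := exists_schwartz_ofReal b.contDiff b.hasCompactSupport
  refine ⟨Metric.closedBall x 1, Metric.closedBall_mem_nhds x one_pos, ?_⟩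
  refine ((hu φ).integrableOn (s := Metric.closedBall x 1)).congr_fun ?_ measurableSet_closedBall
  intro y hy
  have : b y = 1 := b.one_of_mem_closedBall hy
  simp [hφ, this]

theorem ae_eq_of_integral_mul_schwartz_eq {n : ℕ} {u v : E n → ℂ}
    (hu : ∀ φ : 𝓢(E n, ℂ), Integrable fun x => u x * φ x)
    (hv : ∀ φ : 𝓢(E n, ℂ), Integrable fun x => v x * φ x)
    (h : ∀ φ : 𝓢(E n, ℂ), ∫ x, u x * φ x = ∫ x, v x * φ x) : u =ᵐ[volume] v := by
  refine ae_eq_of_integral_contDiff_smul_eq (locallyIntegrable_of_integrable_mul_schwartz hu)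
    (locallyIntegrable_of_integrable_mul_schwartz hv) fun g hg hs => ?_
  obtain ⟨φ, hφ⟩ := exists_schwartz_ofReal hg hs
  simpa [hφ, mul_comm] using h φ

theorem IsFourierTransform.ae_eq {n : ℕ} {u U U' : E n → ℂ} (h : IsFourierTransform u U)
    (h' : IsFourierTransform u U') : U =ᵐ[volume] U' :=
  ae_eq_of_integral_mul_schwartz_eq h.2.1 h'.2.1 fun φ => (h.2.2 φ).trans (h'.2.2 φ).symm

theorem IsFourierTransform.ae_eq_left {n : ℕ} {u u' U U' : E n → ℂ} (h : IsFourierTransform u U)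
    (h' : IsFourierTransform u' U') (hU : U =ᵐ[volume] U') : u =ᵐ[volume] u' := by
  refine ae_eq_of_integral_mul_schwartz_eq h.1 h'.1 fun ψ => ?_
  obtain ⟨φ, hφ⟩ := exists_ft_eq_schwartz ψ
  simp_rw [← hφ]
  rw [← h.2.2 φ, ← h'.2.2 φ]
  refine integral_congr_ae ?_
  filter_upwards [hU] with ξ hξ
  rw [hξ]

/-- `fracLaplacian` is an arbitrary choice among the admissible functions; uniqueness of
distributional transforms, applied to `u` and then to `v`, identifies that choice almost everywhere.
-/
theorem fracLaplacian_invFt {n : ℕ} (a : ℝ) {U : E n → ℂ} (hU : Integrable U)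
    (hU' : Integrable fun ξ => ((‖ξ‖ ^ a : ℝ) : ℂ) * U ξ) :
    fracLaplacian a (invFt U) =ᵐ[volume] invFt fun ξ => ((‖ξ‖ ^ a : ℝ) : ℂ) * U ξ := by
  have hex : ∃ v : E n → ℂ, IsFracLaplacian a (invFt U) v :=
    ⟨_, U, isFourierTransform_invFt hU, isFourierTransform_invFt hU'⟩
  rw [fracLaplacian, dif_pos hex]
  obtain ⟨W, hW, hv⟩ := hex.choose_spec
  refine hv.ae_eq_left (isFourierTransform_invFt hU') ?_
  filter_upwards [hW.ae_eq (isFourierTransform_invFt hU)] with ξ hξ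
  rw [hξ]

/-! ### The symbol of the Riesz potential along the first coordinates -/

/-- The sum of the squares of the first `k` coordinates. -/
def headSq {n : ℕ} (k : ℕ) (ξ : E n) : ℝ := ∑ j : Fin n with j.val < k, ξ j ^ 2

/-- The sum of the squares of the coordinates after the first `k`. -/
def tailSq {n : ℕ} (k : ℕ) (ξ : E n) : ℝ := ∑ j : Fin n with ¬ j.val < k, ξ j ^ 2

/-- The symbol of the potential along the span of the first `k` coordinate vectors. -/
def headSymb {n : ℕ} (k : ℕ) (α : ℝ) (ξ : E n) : ℝ := headSq k ξ ^ (α / 2)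

theorem headSq_nonneg {n : ℕ} (k : ℕ) (ξ : E n) : 0 ≤ headSq k ξ :=
  Finset.sum_nonneg fun _ _ => sq_nonneg _

theorem tailSq_nonneg {n : ℕ} (k : ℕ) (ξ : E n) : 0 ≤ tailSq k ξ :=
  Finset.sum_nonneg fun _ _ => sq_nonneg _

theorem headSq_add_tailSq {n : ℕ} (k : ℕ) (ξ : E n) : headSq k ξ + tailSq k ξ = ‖ξ‖ ^ 2 := by
  rw [headSq, tailSq, Finset.sum_filter_add_sum_filter_not, EuclideanSpace.real_norm_sq_eq]

theorem continuous_headSq {n : ℕ} (k : ℕ) : Continuous (headSq (n := n) k) := by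
  unfold headSq
  fun_prop

theorem continuous_tailSq {n : ℕ} (k : ℕ) : Continuous (tailSq (n := n) k) := by
  unfold tailSq
  fun_prop

theorem headSymb_nonneg {n : ℕ} (k : ℕ) (α : ℝ) (ξ : E n) : 0 ≤ headSymb k α ξ :=
  Real.rpow_nonneg (headSq_nonneg k ξ) _

theorem measurable_headSymb {n : ℕ} (k : ℕ) (α : ℝ) : Measurable (headSymb (n := n) k α) :=
  (continuous_headSq k).measurable.pow_const _

theorem headSymb_smul {n : ℕ} (k : ℕ) (α : ℝ) {t : ℝ} (ht : 0 ≤ t) (ξ : E n) :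
    headSymb k α (t • ξ) = t ^ α * headSymb k α ξ := by
  have h : headSq k (t • ξ) = t ^ 2 * headSq k ξ := by
    simp only [headSq, PiLp.smul_apply, smul_eq_mul, mul_pow, Finset.mul_sum]
  rw [headSymb, headSymb, h, Real.mul_rpow (sq_nonneg _) (headSq_nonneg k ξ),
    ← Real.rpow_natCast t 2, ← Real.rpow_mul ht]
  norm_num
  ring_nf
  simp

/-! ### Local integrability of the symbol -/

theorem integrable_indicator_abs_rpow {a : ℝ} (ha : a < 1) (M : ℝ) :
    Integrable (Set.indicator (Set.Icc (-M) M) fun t : ℝ => |t| ^ (-a)) := by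
  rcases le_or_gt 0 M with hM | hM
  swap
  · rw [Set.Icc_eq_empty (by linarith), Set.indicator_empty]
    exact integrable_zero _ _ _
  have h0 : Integrable (Set.indicator (Set.Icc 0 M) fun t : ℝ => t ^ (-a)) := by
    rw [integrable_indicator_iff measurableSet_Icc, integrableOn_Icc_iff_integrableOn_Ioc,
      ← intervalIntegrable_iff_integrableOn_Ioc_of_le hM]
    exact intervalIntegral.intervalIntegrable_rpow' (by linarith)
  refine (h0.add h0.comp_neg).mono' ?_ (Filter.Eventually.of_forall fun t => ?_)
  · exact ((measurable_norm.pow_const (-a)).indicator measurableSet_Icc).aestronglyMeasurable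
  · have hn1 : 0 ≤ (Set.Icc 0 M).indicator (fun t : ℝ => t ^ (-a)) t :=
      Set.indicator_nonneg (fun x hx => Real.rpow_nonneg hx.1 _) _
    have hn2 : 0 ≤ (Set.Icc 0 M).indicator (fun t : ℝ => t ^ (-a)) (-t) :=
      Set.indicator_nonneg (fun x hx => Real.rpow_nonneg hx.1 _) _
    simp only [Pi.add_apply]
    by_cases ht : t ∈ Set.Icc (-M) M
    · rw [Set.indicator_of_mem ht, Real.norm_of_nonneg (Real.rpow_nonneg (abs_nonneg t) _)]
      rcases le_total 0 t with h | h
      · rw [Set.indicator_of_mem (s := Set.Icc 0 M) (a := t) ⟨h, ht.2⟩, abs_of_nonneg h]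
        linarith
      · rw [Set.indicator_of_mem (s := Set.Icc 0 M) (a := -t) ⟨by linarith, by linarith [ht.1]⟩,
          abs_of_nonpos h]
        linarith
    · rw [Set.indicator_of_notMem ht, norm_zero]
      linarith

/-- Each `|ξ j|` is at most `|ξ'|`, and the `k` exponents `α / k` add up to `α`. Since `α / k < 1`
when `α < k`, this reduces integrability of the singularity to one variable at a time. -/
theorem prod_abs_rpow_le_headSymb {n k : ℕ} (hk : 1 ≤ k) (hkn : k ≤ n) {α : ℝ} (hα : 0 ≤ α)
    (ξ : E n) : ∏ j : Fin n with j.val < k, |ξ j| ^ (α / k) ≤ headSymb k α ξ := by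
  have hcard : (Finset.univ.filter fun j : Fin n => j.val < k).card = k := by
    rw [Fin.card_filter_val_lt, min_eq_right hkn]
  have hk0 : (k : ℝ) ≠ 0 := by positivity
  have hs := headSq_nonneg k ξ
  have : headSymb k α ξ = ∏ j : Fin n with j.val < k, headSq k ξ ^ (α / k / 2) := by
    rw [Finset.prod_const, hcard, headSymb, ← Real.rpow_mul_natCast hs]
    congr 1
    field_simp
  rw [this]
  refine Finset.prod_le_prod (fun j _ => by positivity) fun j hj => ?_
  have h1 : ξ j ^ 2 ≤ headSq k ξ :=
    Finset.single_le_sum (f := fun j => ξ j ^ 2) (fun _ _ => sq_nonneg _) hj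
  calc |ξ j| ^ (α / k) = (ξ j ^ 2) ^ (α / k / 2) := by
        rw [← sq_abs, ← Real.rpow_natCast, ← Real.rpow_mul (abs_nonneg _)]
        congr 1
        push_cast
        ring
    _ ≤ _ := Real.rpow_le_rpow (sq_nonneg _) h1 (by positivity)

theorem ae_coord_ne_zero (n : ℕ) : ∀ᵐ ξ : E n, ∀ j, ξ j ≠ 0 := by
  have h : ∀ᵐ x : Fin n → ℝ, ∀ j, x j ≠ 0 := by
    rw [ae_all_iff]
    intro j
    have : ∀ᵐ t : ℝ, t ≠ 0 := by simp [ae_iff]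
    exact (Measure.quasiMeasurePreserving_eval (μ := fun _ : Fin n => (volume : Measure ℝ)) j).ae this
  exact (PiLp.volume_preserving_ofLp (Fin n)).quasiMeasurePreserving.ae h

theorem integrable_div_headSymb {n k : ℕ} (hk : 1 ≤ k) (hkn : k ≤ n) {α : ℝ} (hα : 0 ≤ α)
    (hαk : α < k) {h : E n → ℂ} (hh : Continuous h) (hs : HasCompactSupport h) :
    Integrable fun ξ => h ξ / (headSymb k α ξ : ℂ) := by
  have hk0 : (0 : ℝ) < k := by positivity
  obtain ⟨C, hC⟩ := hh.bounded_above_of_compact_support hs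
  obtain ⟨M, hM⟩ : ∃ M, ∀ ξ, h ξ ≠ 0 → ‖ξ‖ ≤ M := by
    obtain ⟨M, hM⟩ := hs.isBounded.exists_norm_le
    exact ⟨M, fun ξ hξ => hM ξ (subset_tsupport _ hξ)⟩
  have hprod : Integrable fun ξ : E n => ∏ j : Fin n, Set.indicator (Set.Icc (-M) M)
      (fun t : ℝ => |t| ^ (-(if j.val < k then α / k else 0))) (ξ j) := by
    refine (PiLp.volume_preserving_ofLp (Fin n)).integrable_comp_of_integrable
      (g := fun x : Fin n → ℝ => ∏ j : Fin n, Set.indicator (Set.Icc (-M) M)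
      (fun t : ℝ => |t| ^ (-(if j.val < k then α / k else 0))) (x j)) ?_
    refine Integrable.fintype_prod (fun j => integrable_indicator_abs_rpow ?_ M)
    split_ifs
    · rwa [div_lt_one hk0]
    · exact one_pos
  refine (hprod.const_mul C).mono' ?_ ?_
  · exact (hh.measurable.div (Complex.measurable_ofReal.comp
      (measurable_headSymb k α))).aestronglyMeasurable
  -- The coordinate hyperplanes are discarded so that the product is positive and the inequality
  -- between it and the symbol can be inverted.
  · filter_upwards [ae_coord_ne_zero n] with ξ hξ
    have hpos : 0 < ∏ j : Fin n with j.val < k, |ξ j| ^ (α / k) :=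
      Finset.prod_pos fun j _ => Real.rpow_pos_of_pos (abs_pos.mpr (hξ j)) _
    by_cases h0 : h ξ = 0
    · rw [h0, zero_div, norm_zero]
      refine mul_nonneg ((norm_nonneg _).trans (hC 0)) (Finset.prod_nonneg fun j _ => ?_)
      exact Set.indicator_nonneg (fun x _ => Real.rpow_nonneg (abs_nonneg x) _) _
    have hmem : ∀ j, ξ j ∈ Set.Icc (-M) M := fun j =>
      abs_le.mp ((PiLp.norm_apply_le ξ j).trans (hM ξ h0))
    have heq : ∏ j : Fin n, Set.indicator (Set.Icc (-M) M)
        (fun t : ℝ => |t| ^ (-(if j.val < k then α / k else 0))) (ξ j) =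
        (∏ j : Fin n with j.val < k, |ξ j| ^ (α / k))⁻¹ := by
      rw [Finset.prod_filter, ← Finset.prod_inv_distrib]
      refine Finset.prod_congr rfl fun j _ => ?_
      rw [Set.indicator_of_mem (hmem j)]
      split_ifs
      · rw [Real.rpow_neg (abs_nonneg _)]
      · simp
    rw [heq, norm_div, Complex.norm_real, Real.norm_of_nonneg (headSymb_nonneg k α ξ),
      div_eq_mul_inv]
    exact mul_le_mul (hC ξ) (inv_anti₀ hpos (prod_abs_rpow_le_headSymb hk hkn hα ξ))
      (inv_nonneg.mpr (headSymb_nonneg k α ξ)) ((norm_nonneg _).trans (hC 0))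

/-! ### Rotations -/

theorem inner_rotE {n : ℕ} (Q : SO n) (j : Fin n) (ξ : E n) :
    inner ℝ (rotE Q j) ξ = ∑ i, Q.1 i j * ξ i := by
  simp [rotE, PiLp.inner_apply, mul_comm]

theorem orthonormal_rotE {n : ℕ} (Q : SO n) : Orthonormal ℝ (rotE Q) := by
  rw [orthonormal_iff_ite]
  intro i j
  have h := congrFun (congrFun ((SO.mem_iff Q.1).mp Q.2).1 i) j
  rw [Matrix.mul_apply, Matrix.one_apply] at h
  rw [inner_rotE, ← h]
  simp [rotE]

/-- The coordinates with respect to the basis `Q e₁, …, Q eₙ`, as an isometry: this is `Q⁻¹`. -/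
def rotCoord {n : ℕ} (Q : SO n) : E n ≃ₗᵢ[ℝ] E n :=
  (OrthonormalBasis.mk (orthonormal_rotE Q) (by
    rw [(orthonormal_rotE Q).linearIndependent.span_eq_top_of_card_eq_finrank' (by simp)])).repr

theorem rotCoord_apply {n : ℕ} (Q : SO n) (ξ : E n) (j : Fin n) :
    rotCoord Q ξ j = inner ℝ (rotE Q j) ξ := by
  rw [rotCoord, OrthonormalBasis.repr_apply_apply, OrthonormalBasis.coe_mk]

theorem symb_eq_headSymb {n : ℕ} (k : ℕ) (α : ℝ) (ξ : E n) (Q : SO n) :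
    symb k α ξ Q = headSymb k α (rotCoord Q ξ) := by
  rw [symb, headSymb, headSq]
  simp only [rotCoord_apply]
  rw [abs_of_nonneg (Finset.sum_nonneg fun _ _ => sq_nonneg _)]

theorem integrable_div_symb {n k : ℕ} (hk : 1 ≤ k) (hkn : k ≤ n) {α : ℝ} (hα : 0 ≤ α)
    (hαk : α < k) (Q : SO n) {h : E n → ℂ} (hh : Continuous h) (hs : HasCompactSupport h) :
    Integrable fun ξ => h ξ / (symb k α ξ Q : ℂ) := by
  have h1 := integrable_div_headSymb hk hkn hα hαk (hh.comp (rotCoord Q).symm.continuous)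
    (hs.comp_homeomorph (rotCoord Q).symm.toHomeomorph)
  refine (((rotCoord Q).measurePreserving).integrable_comp_of_integrable h1).congr
    (Filter.Eventually.of_forall fun ξ => ?_)
  simp [symb_eq_headSymb]

/-! ### A compactly supported function with nonnegative Fourier transform -/

theorem exp_I_inner_add {n : ℕ} (ζ x y : E n) :
    Complex.exp (Complex.I * ((inner ℝ ζ (x + y) : ℝ) : ℂ)) =
      Complex.exp (Complex.I * ((inner ℝ ζ x : ℝ) : ℂ)) *
        Complex.exp (Complex.I * ((inner ℝ ζ y : ℝ) : ℂ)) := by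
  rw [inner_add_right, ← Complex.exp_add]
  push_cast
  ring_nf

/-- Multiplication by a character distributes over convolution, and the integral of a convolution is
the product of the integrals. -/
theorem integral_exp_mul_convolution {n : ℕ} {χ : E n → ℝ} (hχ : Integrable χ) (ζ : E n) :
    ∫ x, Complex.exp (Complex.I * ((inner ℝ ζ x : ℝ) : ℂ)) *
        ((convolution χ χ (ContinuousLinearMap.mul ℝ ℝ) volume x : ℝ) : ℂ) =
      (∫ x, Complex.exp (Complex.I * ((inner ℝ ζ x : ℝ) : ℂ)) * (χ x : ℂ)) ^ 2 := by
  have hint : Integrable fun x => Complex.exp (Complex.I * ((inner ℝ ζ x : ℝ) : ℂ)) * (χ x : ℂ) :=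
    hχ.ofReal.bdd_mul (c := 1) (by fun_prop : Continuous fun x : E n =>
      Complex.exp (Complex.I * ((inner ℝ ζ x : ℝ) : ℂ))).aestronglyMeasurable
      (Filter.Eventually.of_forall fun x => (norm_exp_I_mul_ofReal _).le)
  have h := integral_convolution (ContinuousLinearMap.mul ℝ ℂ) hint hint
  rw [ContinuousLinearMap.mul_apply', ← sq] at h
  rw [← h]
  refine integral_congr_ae (Filter.Eventually.of_forall fun x => ?_)
  simp only [convolution_def, ContinuousLinearMap.mul_apply']
  rw [← integral_complex_ofReal, ← integral_const_mul]
  refine integral_congr_ae (Filter.Eventually.of_forall fun t => ?_)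
  simp only
  have := exp_I_inner_add ζ t (x - t)
  rw [add_sub_cancel] at this
  rw [this]
  push_cast
  ring

/-- The sine part is odd and vanishes. The transform is therefore real, which makes its square
nonnegative. -/
theorem integral_exp_mul_even {n : ℕ} {χ : E n → ℝ} (hχ : Integrable χ)
    (heven : ∀ x, χ (-x) = χ x) (ζ : E n) :
    ∫ x, Complex.exp (Complex.I * ((inner ℝ ζ x : ℝ) : ℂ)) * (χ x : ℂ) =
      ((∫ x, Real.cos (inner ℝ ζ x) * χ x : ℝ) : ℂ) := by
  have hcos : Integrable fun x => Real.cos (inner ℝ ζ x) * χ x :=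
    hχ.bdd_mul (c := 1) (by fun_prop : Continuous fun x : E n =>
      Real.cos (inner ℝ ζ x)).aestronglyMeasurable
      (Filter.Eventually.of_forall fun x => Real.abs_cos_le_one _)
  have hsin : Integrable fun x => Real.sin (inner ℝ ζ x) * χ x :=
    hχ.bdd_mul (c := 1) (by fun_prop : Continuous fun x : E n =>
      Real.sin (inner ℝ ζ x)).aestronglyMeasurable
      (Filter.Eventually.of_forall fun x => Real.abs_sin_le_one _)
  have h0 : ∫ x, Real.sin (inner ℝ ζ x) * χ x = 0 := by
    have h := integral_neg_eq_self (fun x => Real.sin (inner ℝ ζ x) * χ x) volume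
    simp only [inner_neg_right, Real.sin_neg, heven, neg_mul, integral_neg] at h
    linarith
  have h1 : ∀ x, Complex.exp (Complex.I * ((inner ℝ ζ x : ℝ) : ℂ)) * (χ x : ℂ) =
      ((Real.cos (inner ℝ ζ x) * χ x : ℝ) : ℂ) +
        Complex.I * ((Real.sin (inner ℝ ζ x) * χ x : ℝ) : ℂ) := by
    intro x
    rw [mul_comm Complex.I, Complex.exp_mul_I]
    push_cast
    ring
  simp_rw [h1]
  rw [integral_add hcos.ofReal (hsin.ofReal.const_mul _), integral_const_mul,
    integral_complex_ofReal, integral_complex_ofReal, h0]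
  simp

/-- There is a continuous nonnegative function supported in the unit ball whose Fourier transform
is nonnegative, and bounded from below on the ball of radius `2`. -/
theorem exists_positive_definite_bump (n : ℕ) :
    ∃ Φ : E n → ℝ, Continuous Φ ∧ HasCompactSupport Φ ∧ (∀ x, 0 ≤ Φ x) ∧
      (∀ x, Φ x ≠ 0 → ‖x‖ < 1) ∧
      ∃ h : E n → ℝ, (∀ ζ, 0 ≤ h ζ) ∧ (∀ ζ, invFt (fun x => (Φ x : ℂ)) ζ = (h ζ : ℂ)) ∧
        ∃ δ : ℝ, 0 < δ ∧ ∀ ζ, ‖ζ‖ ≤ 2 → δ ≤ h ζ := by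
  -- The outer radius `1/3` places `χ * χ` inside the unit ball. It also gives `|ζ · x| ≤ 2/3` for
  -- `‖ζ‖ ≤ 2` on the support of `χ`, where the cosine is at least `1 - (2/3)²/2 > 1/2`.
  let b : ContDiffBump (0 : E n) := ⟨1 / 4, 1 / 3, by norm_num, by norm_num⟩
  obtain ⟨χ, hχdef⟩ : ∃ χ : E n → ℝ, χ = b := ⟨_, rfl⟩
  have hχc : Continuous χ := hχdef ▸ b.continuous
  have hχs : HasCompactSupport χ := hχdef ▸ b.hasCompactSupport
  have hχi : Integrable χ := hχc.integrable_of_hasCompactSupport hχs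
  have hχ0 : ∀ x, 0 ≤ χ x := fun x => hχdef ▸ b.nonneg
  have hχsupp : ∀ x, χ x ≠ 0 → ‖x‖ < 1 / 3 := by
    intro x hx
    have : x ∈ Function.support b := by rw [← hχdef]; exact hx
    rw [b.support_eq] at this
    exact mem_ball_zero_iff.mp this
  have hχe : ∀ x, χ (-x) = χ x := fun x => hχdef ▸ b.neg x
  have hχpos : 0 < ∫ x, χ x := hχdef ▸ b.integral_pos
  have hΦsupp : ∀ x, convolution χ χ (ContinuousLinearMap.mul ℝ ℝ) volume x ≠ 0 → ‖x‖ < 1 := by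
    intro x hx
    obtain ⟨y, hy, z, hz, rfl⟩ :=
      support_convolution_subset (ContinuousLinearMap.mul ℝ ℝ) (μ := (volume : Measure (E n))) hx
    have h1 := hχsupp y hy
    have h2 := hχsupp z hz
    have := norm_add_le y z
    simp only
    linarith
  refine ⟨convolution χ χ (ContinuousLinearMap.mul ℝ ℝ) volume,
    hχs.continuous_convolution_right _ hχi.locallyIntegrable hχc,
    hχs.convolution _ hχs, ?_, hΦsupp,
    fun ζ => (2 * Real.pi) ^ (-(n : ℝ) / 2) * (∫ x, Real.cos (inner ℝ ζ x) * χ x) ^ 2, ?_, ?_,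
    (2 * Real.pi) ^ (-(n : ℝ) / 2) * ((∫ x, χ x) / 2) ^ 2, ?_, ?_⟩
  · intro x
    rw [convolution_def]
    exact integral_nonneg fun t => mul_nonneg (hχ0 _) (hχ0 _)
  · intro ζ
    have := unitaryConst_pos n
    positivity
  · intro ζ
    rw [invFt, integral_exp_mul_convolution hχi, integral_exp_mul_even hχi hχe]
    push_cast
    ring
  · have := unitaryConst_pos n
    positivity
  · intro ζ hζ
    refine mul_le_mul_of_nonneg_left ?_ (unitaryConst_pos n).le
    refine pow_le_pow_left₀ (by positivity) ?_ 2
    rw [div_eq_inv_mul, ← integral_const_mul]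
    refine integral_mono (hχi.const_mul _) (hχi.bdd_mul (c := 1) (by fun_prop : Continuous fun x : E n =>
      Real.cos (inner ℝ ζ x)).aestronglyMeasurable
      (Filter.Eventually.of_forall fun x => Real.abs_cos_le_one _)) fun x => ?_
    simp only
    by_cases hx : χ x = 0
    · simp [hx]
    refine mul_le_mul_of_nonneg_right ?_ (hχ0 x)
    have h1 : |(inner ℝ ζ x : ℝ)| ≤ 2 / 3 := by
      refine (abs_real_inner_le_norm ζ x).trans ?_
      have := (hχsupp x hx).le
      nlinarith [norm_nonneg ζ, norm_nonneg x]
    have h2 := Real.one_sub_sq_div_two_le_cos (x := inner ℝ ζ x)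
    have h3 : (inner ℝ ζ x : ℝ) ^ 2 ≤ (2 / 3) ^ 2 := sq_le_sq' (abs_le.mp h1).1 (abs_le.mp h1).2
    linarith

/-! ### Linear changes of variables -/

theorem integral_comp_linearEquiv {n : ℕ} {F : Type*} [NormedAddCommGroup F] [NormedSpace ℝ F]
    (L : E n ≃L[ℝ] E n) (f : E n → F) :
    ∫ x, f (L x) = |(LinearMap.det (L : E n →ₗ[ℝ] E n))⁻¹| • ∫ x, f x := by
  have hdet : LinearMap.det (L : E n →ₗ[ℝ] E n) ≠ 0 :=
    (LinearEquiv.isUnit_det' L.toLinearEquiv).ne_zero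
  have h := Measure.map_linearMap_addHaar_eq_smul_addHaar (volume : Measure (E n)) hdet
  have h2 : ∫ x, f (L x) = ∫ y, f y ∂(Measure.map L volume) :=
    (L.toHomeomorph.measurableEmbedding.integral_map f).symm
  rw [h2, show (L : E n → E n) = (L : E n →ₗ[ℝ] E n) from rfl, h, integral_smul_measure,
    ENNReal.toReal_ofReal (abs_nonneg _)]

theorem integrable_comp_linearEquiv {n : ℕ} {F : Type*} [NormedAddCommGroup F]
    (L : E n ≃L[ℝ] E n) {f : E n → F} (hf : Integrable f) : Integrable fun x => f (L x) := by
  have hdet : LinearMap.det (L : E n →ₗ[ℝ] E n) ≠ 0 :=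
    (LinearEquiv.isUnit_det' L.toLinearEquiv).ne_zero
  have h := Measure.map_linearMap_addHaar_eq_smul_addHaar (volume : Measure (E n)) hdet
  have h2 : Integrable f (Measure.map L volume) := by
    rw [show (L : E n → E n) = (L : E n →ₗ[ℝ] E n) from rfl, h]
    exact hf.smul_measure ENNReal.ofReal_ne_top
  exact (L.toHomeomorph.measurableEmbedding.integrable_map_iff).mp h2

/-- Pairing an inverse Fourier transform with a linearly transformed function. -/
theorem integral_invFt_mul_comp {n : ℕ} (L : E n ≃L[ℝ] E n)
    (hL : ∀ x y, inner ℝ (L x) y = (inner ℝ x (L y) : ℝ)) {U h : E n → ℂ} (hU : Integrable U)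
    (hh : Integrable h) :
    ∫ x, invFt U x * h (L x) = ∫ ζ, U (L ζ) * invFt h ζ := by
  rw [integral_invFt_mul hU (integrable_comp_linearEquiv L hh)]
  have hdet : LinearMap.det (L : E n →ₗ[ℝ] E n) ≠ 0 :=
    (LinearEquiv.isUnit_det' L.toLinearEquiv).ne_zero
  -- By symmetry of `L`, the transform of `h ∘ L` at `L ξ` is that of `h` at `ξ` up to the Jacobian;
  -- the substitution `ξ ↦ L ξ` produces the same Jacobian, and the two cancel.
  have h1 : ∀ ξ, invFt (fun x => h (L x)) (L ξ) =
      ((|(LinearMap.det (L : E n →ₗ[ℝ] E n))⁻¹| : ℝ) : ℂ) * invFt h ξ := by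
    intro ξ
    have := integral_comp_linearEquiv L
      (fun x => Complex.exp (Complex.I * ((inner ℝ ξ x : ℝ) : ℂ)) * h x)
    simp only [invFt]
    simp_rw [hL]
    rw [this, Complex.real_smul]
    ring
  have h2 := integral_comp_linearEquiv L (fun ξ => U ξ * invFt (fun x => h (L x)) ξ)
  simp only [h1, mul_left_comm (U _) (((|(LinearMap.det (L : E n →ₗ[ℝ] E n))⁻¹| : ℝ) : ℂ))] at h2
  rw [integral_const_mul, Complex.real_smul] at h2
  exact (mul_left_cancel₀ (by simpa using hdet) h2).symm

/-- The linear map that multiplies the first `k` coordinates by `r`. -/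
def headScaleMap {n : ℕ} (k : ℕ) (r : ℝ) : E n →ₗ[ℝ] E n :=
  Matrix.toLpLin 2 2 (Matrix.diagonal fun j : Fin n => if j.val < k then r else 1)

theorem headScaleMap_apply {n : ℕ} (k : ℕ) (r : ℝ) (x : E n) (j : Fin n) :
    headScaleMap k r x j = (if j.val < k then r else 1) * x j := by
  simp [headScaleMap, Matrix.toLpLin_apply, Matrix.mulVec_diagonal]

theorem det_headScaleMap {n k : ℕ} (hkn : k ≤ n) (r : ℝ) :
    LinearMap.det (headScaleMap (n := n) k r) = r ^ k := by
  rw [headScaleMap, LinearMap.det_toLpLin, Matrix.det_diagonal, Finset.prod_ite]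
  simp [Fin.card_filter_val_lt, min_eq_right hkn]

/-- The linear equivalence that multiplies the first `k` coordinates by `r`. -/
def headScale {n : ℕ} (k : ℕ) (r : ℝ) (hr : r ≠ 0) : E n ≃L[ℝ] E n :=
  LinearEquiv.toContinuousLinearEquiv
    { headScaleMap k r with
      invFun := headScaleMap k r⁻¹
      left_inv := fun x => by
        ext j
        change headScaleMap k r⁻¹ (headScaleMap k r x) j = x j
        rw [headScaleMap_apply, headScaleMap_apply]
        split_ifs <;> simp [hr]
      right_inv := fun x => by
        ext j
        change headScaleMap k r (headScaleMap k r⁻¹ x) j = x j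
        rw [headScaleMap_apply, headScaleMap_apply]
        split_ifs <;> simp [hr] }

theorem headScale_apply {n : ℕ} (k : ℕ) (r : ℝ) (hr : r ≠ 0) (x : E n) (j : Fin n) :
    headScale k r hr x j = (if j.val < k then r else 1) * x j :=
  headScaleMap_apply k r x j

theorem det_headScale {n k : ℕ} (hkn : k ≤ n) (r : ℝ) (hr : r ≠ 0) :
    LinearMap.det (headScale (n := n) k r hr : E n →ₗ[ℝ] E n) = r ^ k :=
  det_headScaleMap hkn r

theorem inner_headScale {n : ℕ} (k : ℕ) (r : ℝ) (hr : r ≠ 0) (x y : E n) :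
    inner ℝ (headScale k r hr x) y = (inner ℝ x (headScale k r hr y) : ℝ) := by
  simp only [PiLp.inner_apply, headScale_apply]
  refine Finset.sum_congr rfl fun j _ => ?_
  simp only [RCLike.inner_apply, conj_trivial]
  ring

theorem headSq_headScale {n : ℕ} (k : ℕ) (r : ℝ) (hr : r ≠ 0) (x : E n) :
    headSq k (headScale k r hr x) = r ^ 2 * headSq k x := by
  simp only [headSq, headScale_apply, Finset.mul_sum]
  refine Finset.sum_congr rfl fun j hj => ?_
  rw [if_pos (Finset.mem_filter.mp hj).2, mul_pow]

theorem tailSq_headScale {n : ℕ} (k : ℕ) (r : ℝ) (hr : r ≠ 0) (x : E n) :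
    tailSq k (headScale k r hr x) = tailSq k x := by
  simp only [tailSq, headScale_apply]
  refine Finset.sum_congr rfl fun j hj => ?_
  rw [if_neg (Finset.mem_filter.mp hj).2, one_mul]

theorem headSymb_headScale {n : ℕ} (k : ℕ) (α : ℝ) {r : ℝ} (hr : 0 < r) (x : E n) :
    headSymb k α (headScale k r hr.ne' x) = r ^ α * headSymb k α x := by
  rw [headSymb, headSymb, headSq_headScale, Real.mul_rpow (sq_nonneg _) (headSq_nonneg k x),
    ← Real.rpow_natCast r 2, ← Real.rpow_mul hr.le]
  congr 2
  push_cast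
  ring

/-! ### The model function -/

/-- A smooth bump on the real line that is `1` on `[1, 4]` and `0` outside of `[1/2, 9/2]`. -/
def lineBump : ContDiffBump (5 / 2 : ℝ) := ⟨3 / 2, 2, by norm_num, by norm_num⟩

/-- A smooth radial function that is `1` for `1 ≤ |ξ| ≤ 2` and `0` unless `1/2 ≤ |ξ|² ≤ 9/2`. -/
def annulusBump {n : ℕ} (ξ : E n) : ℝ := lineBump (‖ξ‖ ^ 2)

open scoped ContDiff in
theorem contDiff_annulusBump (n : ℕ) : ContDiff ℝ ∞ (annulusBump (n := n)) :=
  lineBump.contDiff.comp (contDiff_norm_sq ℝ)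

theorem annulusBump_nonneg {n : ℕ} (ξ : E n) : 0 ≤ annulusBump ξ := lineBump.nonneg

theorem annulusBump_le_one {n : ℕ} (ξ : E n) : annulusBump ξ ≤ 1 := lineBump.le_one

theorem annulusBump_eq_one {n : ℕ} {ξ : E n} (h1 : 1 ≤ ‖ξ‖ ^ 2) (h2 : ‖ξ‖ ^ 2 ≤ 4) :
    annulusBump ξ = 1 := by
  refine lineBump.one_of_mem_closedBall ?_
  rw [Metric.mem_closedBall, Real.dist_eq, abs_le]
  change -(3 / 2 : ℝ) ≤ _ ∧ _ ≤ (3 / 2 : ℝ)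
  constructor <;> linarith

theorem annulusBump_ne_zero {n : ℕ} {ξ : E n} (h : annulusBump ξ ≠ 0) :
    1 / 2 < ‖ξ‖ ^ 2 ∧ ‖ξ‖ ^ 2 < 9 / 2 := by
  by_contra hc
  refine h (lineBump.zero_of_le_dist ?_)
  rw [Real.dist_eq, le_abs]
  change (2 : ℝ) ≤ _ ∨ (2 : ℝ) ≤ _
  rcases lt_or_ge (1 / 2) (‖ξ‖ ^ 2) with h1 | h1
  · have h2 : ¬ ‖ξ‖ ^ 2 < 9 / 2 := fun h2 => hc ⟨h1, h2⟩
    left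
    linarith
  · right
    linarith

theorem hasCompactSupport_annulusBump (n : ℕ) : HasCompactSupport (annulusBump (n := n)) := by
  refine HasCompactSupport.intro (isCompact_closedBall (0 : E n) 3) fun ξ hξ => ?_
  by_contra h
  refine hξ (mem_closedBall_zero_iff.mpr ?_)
  have := (annulusBump_ne_zero h).2
  nlinarith [norm_nonneg ξ]

/-- The Fourier transform of the model function. -/
def profile {n : ℕ} (k : ℕ) (α : ℝ) (ξ : E n) : ℝ :=
  ‖ξ‖ ^ α * annulusBump ξ / headSymb k α ξ

theorem profile_nonneg {n : ℕ} (k : ℕ) (α : ℝ) (ξ : E n) : 0 ≤ profile k α ξ := by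
  have := annulusBump_nonneg ξ
  have := headSymb_nonneg k α ξ
  unfold profile
  positivity

theorem continuous_norm_rpow_mul_annulusBump (n : ℕ) {α : ℝ} (hα : 0 ≤ α) :
    Continuous fun ξ : E n => ((‖ξ‖ ^ α * annulusBump ξ : ℝ) : ℂ) :=
  Complex.continuous_ofReal.comp ((continuous_norm.rpow_const fun _ => Or.inr hα).mul
    (contDiff_annulusBump n).continuous)

theorem hasCompactSupport_norm_rpow_mul_annulusBump (n : ℕ) (α : ℝ) :
    HasCompactSupport fun ξ : E n => ((‖ξ‖ ^ α * annulusBump ξ : ℝ) : ℂ) :=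
  ((hasCompactSupport_annulusBump n).mul_left (f := fun ξ : E n => ‖ξ‖ ^ α)).comp_left
    Complex.ofReal_zero

theorem integrable_profile {n k : ℕ} (hk : 1 ≤ k) (hkn : k ≤ n) {α : ℝ} (hα : 0 ≤ α)
    (hαk : α < k) : Integrable fun ξ : E n => (profile k α ξ : ℂ) := by
  refine (integrable_div_headSymb hk hkn hα hαk (continuous_norm_rpow_mul_annulusBump n hα)
    (hasCompactSupport_norm_rpow_mul_annulusBump n α)).congr
      (Filter.Eventually.of_forall fun ξ => ?_)
  simp [profile]

/-- The region used for lower bounds. -/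
def goodRegion (n k : ℕ) : Set (E n) := {ζ | 0 < headSq k ζ ∧ 1 < tailSq k ζ ∧ ‖ζ‖ ^ 2 < 4}

theorem isOpen_goodRegion (n k : ℕ) : IsOpen (goodRegion n k) :=
  (isOpen_lt continuous_const (continuous_headSq k)).inter
    ((isOpen_lt continuous_const (continuous_tailSq k)).inter
      (isOpen_lt (continuous_norm.pow 2) continuous_const))

theorem goodRegion_nonempty {n k : ℕ} (hk : 1 ≤ k) (hkn : k < n) : (goodRegion n k).Nonempty := by
  let i : Fin n := ⟨0, by omega⟩
  let l : Fin n := ⟨k, hkn⟩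
  have hil : i ≠ l := by
    intro h
    have := congrArg Fin.val h
    simp only [i, l] at this
    omega
  -- One head coordinate `1` and one tail coordinate `3/2`: the head sum is `1`, the tail sum `9/4`,
  -- and the total `13/4 < 4`. The tail coordinate exists because `k < n`.
  let ζ : E n := WithLp.toLp 2 (fun j => if j = i then 1 else if j = l then 3 / 2 else 0)
  have hhead : headSq k ζ = 1 := by
    rw [headSq, Finset.sum_eq_single i]
    · simp [ζ]
    · intro j hj hji
      have : j ≠ l := by
        rintro rfl
        simp [l] at hj
      simp [ζ, hji, this]
    · intro h
      refine absurd (Finset.mem_filter.mpr ⟨Finset.mem_univ _, ?_⟩) h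
      simp only [i]
      omega
  have htail : tailSq k ζ = 9 / 4 := by
    rw [tailSq, Finset.sum_eq_single l]
    · simp only [ζ, if_neg hil.symm, if_true]
      norm_num
    · intro j hj hji
      have : j ≠ i := by
        rintro rfl
        simp only [i, Finset.mem_filter] at hj
        omega
      simp [ζ, hji, this]
    · intro h
      refine absurd (Finset.mem_filter.mpr ⟨Finset.mem_univ _, ?_⟩) h
      simp [l]
  refine ⟨ζ, ?_, ?_, ?_⟩
  · rw [hhead]
    exact one_pos
  · rw [htail]
    norm_num
  · rw [← headSq_add_tailSq k, hhead, htail]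
    norm_num

theorem volume_goodRegion_lt_top (n k : ℕ) : volume (goodRegion n k) < ⊤ := by
  refine lt_of_le_of_lt (measure_mono fun ζ hζ => ?_)
    (measure_closedBall_lt_top (x := (0 : E n)) (r := 2))
  rw [mem_closedBall_zero_iff]
  have := hζ.2.2
  nlinarith [norm_nonneg ζ]

theorem volume_goodRegion_pos {n k : ℕ} (hk : 1 ≤ k) (hkn : k < n) :
    0 < volume.real (goodRegion n k) :=
  ENNReal.toReal_pos ((isOpen_goodRegion n k).measure_pos _ (goodRegion_nonempty hk hkn)).ne'
    (volume_goodRegion_lt_top n k).ne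

/-- In `goodRegion` the tail alone exceeds `1`, so compressing the head keeps the point in the
annulus where the bump equals `1`, while the symbol in the denominator shrinks by `r^{-α}`. -/
theorem le_profile_headScale {n k : ℕ} {α : ℝ} (hα : 0 ≤ α) {r : ℝ} (hr : 1 ≤ r)
    {ζ : E n} (hζ : ζ ∈ goodRegion n k) :
    r ^ α * (2 ^ α)⁻¹ ≤ profile k α (headScale k r⁻¹ (by positivity) ζ) := by
  obtain ⟨h1, h2, h3⟩ := hζ
  have hr0 : 0 < r := by linarith
  have hri : 0 < r⁻¹ := by positivity
  have hsum := headSq_add_tailSq k ζ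
  have hn : ‖headScale k r⁻¹ hri.ne' ζ‖ ^ 2 = r⁻¹ ^ 2 * headSq k ζ + tailSq k ζ := by
    rw [← headSq_add_tailSq k, headSq_headScale, tailSq_headScale]
  have hle : r⁻¹ ^ 2 * headSq k ζ ≤ headSq k ζ := by
    have : r⁻¹ ^ 2 ≤ 1 := pow_le_one₀ hri.le (inv_le_one_of_one_le₀ hr)
    nlinarith
  have hge : 0 ≤ r⁻¹ ^ 2 * headSq k ζ := by positivity
  have hn1 : 1 ≤ ‖headScale k r⁻¹ hri.ne' ζ‖ ^ 2 := by rw [hn]; linarith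
  have hn2 : ‖headScale k r⁻¹ hri.ne' ζ‖ ^ 2 ≤ 4 := by rw [hn]; linarith
  have hn3 : 1 ≤ ‖headScale k r⁻¹ hri.ne' ζ‖ := by
    nlinarith [norm_nonneg (headScale k r⁻¹ hri.ne' ζ)]
  have hs1 : 0 < headSymb k α ζ := Real.rpow_pos_of_pos h1 _
  have hs2 : headSymb k α ζ ≤ 2 ^ α := by
    calc headSymb k α ζ ≤ (2 ^ 2 : ℝ) ^ (α / 2) := by
          refine Real.rpow_le_rpow h1.le ?_ (by positivity)
          linarith
      _ = 2 ^ α := by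
          rw [← Real.rpow_natCast, ← Real.rpow_mul (by norm_num)]
          congr 1
          push_cast
          ring
  rw [profile, annulusBump_eq_one hn1 hn2, headSymb_headScale k α hri, mul_one,
    Real.inv_rpow hr0.le, div_eq_mul_inv, mul_inv, inv_inv]
  calc r ^ α * (2 ^ α)⁻¹ ≤ r ^ α * (headSymb k α ζ)⁻¹ := by
        gcongr
    _ ≤ _ := le_mul_of_one_le_left (by positivity) (Real.one_le_rpow hn3 hα)

/-- Lower bound for the pairing of the model function with a stretched test function. -/
theorem exists_pairing_lower_bound {n k : ℕ} (hk : 1 ≤ k) (hkn : k < n) {α : ℝ} (hα : 0 ≤ α)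
    (hαk : α < k) :
    ∃ Φ : E n → ℝ, Continuous Φ ∧ HasCompactSupport Φ ∧ (∀ x, 0 ≤ Φ x) ∧
      (∀ x, Φ x ≠ 0 → ‖x‖ < 1) ∧ ∃ c : ℝ, 0 < c ∧ ∀ (r : ℝ) (hr0 : r⁻¹ ≠ 0), 1 ≤ r →
        c * r ^ α ≤ (∫ x, invFt (fun ξ => (profile k α ξ : ℂ)) x *
          (Φ (headScale k r⁻¹ hr0 x) : ℂ)).re := by
  obtain ⟨Φ, hΦc, hΦs, hΦ0, hΦ1, h, hh0, hh, δ, hδ, hδh⟩ := exists_positive_definite_bump n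
  refine ⟨Φ, hΦc, hΦs, hΦ0, hΦ1, (2 ^ α)⁻¹ * δ * volume.real (goodRegion n k), ?_, ?_⟩
  · have := volume_goodRegion_pos hk hkn
    positivity
  intro r hr0 hr
  have hV := integrable_profile hk hkn.le hα hαk
  have hΦi : Integrable fun x => (Φ x : ℂ) := (hΦc.integrable_of_hasCompactSupport hΦs).ofReal
  -- On the frequency side both factors of the integrand are nonnegative, so restricting to
  -- `goodRegion` only decreases the integral.
  rw [integral_invFt_mul_comp _ (inner_headScale k r⁻¹ hr0) hV hΦi]
  simp only [hh, ← Complex.ofReal_mul]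
  rw [integral_complex_ofReal, Complex.ofReal_re]
  have hVr : Integrable fun ζ : E n => profile k α (headScale k r⁻¹ hr0 ζ) :=
    integrable_comp_linearEquiv _ (f := profile k α) (by simpa using hV.re)
  have hhc : Continuous h := by
    have : h = fun ζ => (invFt (fun x => (Φ x : ℂ)) ζ).re := by
      ext ζ
      rw [hh, Complex.ofReal_re]
    rw [this]
    exact Complex.continuous_re.comp (continuous_invFt hΦi)
  have hint : Integrable fun ζ : E n => profile k α (headScale k r⁻¹ hr0 ζ) * h ζ := by
    refine hVr.mul_bdd (c := (2 * Real.pi) ^ (-(n : ℝ) / 2) * ∫ x, ‖(Φ x : ℂ)‖)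
      hhc.aestronglyMeasurable (Filter.Eventually.of_forall fun ζ => ?_)
    have := norm_invFt_le (fun x => (Φ x : ℂ)) ζ
    rwa [hh, Complex.norm_real] at this
  have hmeas := (isOpen_goodRegion n k).measurableSet
  calc (2 ^ α)⁻¹ * δ * volume.real (goodRegion n k) * r ^ α
      = ∫ _ in goodRegion n k, r ^ α * (2 ^ α)⁻¹ * δ := by
        rw [setIntegral_const, smul_eq_mul]
        ring
    _ ≤ ∫ ζ in goodRegion n k, profile k α (headScale k r⁻¹ hr0 ζ) * h ζ := by
        refine setIntegral_mono_on (integrableOn_const (volume_goodRegion_lt_top n k).ne)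
          hint.integrableOn hmeas fun ζ hζ => ?_
        refine mul_le_mul (le_profile_headScale hα hr hζ) (hδh ζ ?_) hδ.le (profile_nonneg _ _ _)
        have := hζ.2.2
        nlinarith [norm_nonneg ζ]
    _ ≤ ∫ ζ, profile k α (headScale k r⁻¹ hr0 ζ) * h ζ :=
        setIntegral_le_integral hint (Filter.Eventually.of_forall fun ζ =>
          mul_nonneg (profile_nonneg _ _ _) (hh0 ζ))

/-! ### Lower bounds for the localized norm of the model function -/

theorem norm_le_mul_norm_headScale {n : ℕ} (k : ℕ) {r : ℝ} (hr : 1 ≤ r) (hr0 : r⁻¹ ≠ 0)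
    (x : E n) : ‖x‖ ≤ r * ‖headScale k r⁻¹ hr0 x‖ := by
  have hr1 : 0 < r := by linarith
  refine abs_le_of_sq_le_sq' ?_ (by positivity) |>.2
  rw [mul_pow, ← headSq_add_tailSq k, ← headSq_add_tailSq k, headSq_headScale, tailSq_headScale,
    mul_add, ← mul_assoc, ← mul_pow, mul_inv_cancel₀ hr1.ne', one_pow, one_mul]
  have : 1 ≤ r ^ 2 := one_le_pow₀ hr
  have := tailSq_nonneg k x
  nlinarith

theorem sq_rpow_half (a : ENNReal) : (a ^ (1 / 2 : ℝ)) ^ 2 = a := by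
  rw [← ENNReal.rpow_natCast, ← ENNReal.rpow_mul]
  norm_num

theorem sq_eLpNorm_two {X : Type*} [MeasurableSpace X] (μ : Measure X) (v : X → ℂ) :
    eLpNorm v 2 μ ^ 2 = ∫⁻ x, ‖v x‖ₑ ^ (2 : ℝ) ∂μ := by
  rw [eLpNorm_eq_lintegral_rpow_enorm_toReal two_ne_zero ENNReal.ofNat_ne_top,
    ← ENNReal.rpow_natCast, ← ENNReal.rpow_mul]
  norm_num

/-- Cauchy–Schwarz on the ball that contains the support of `η`. -/
theorem ofReal_sq_norm_integral_mul_le {n : ℕ} {v : E n → ℂ} (hv : Continuous v) {η : E n → ℝ}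
    (hη : Continuous η) (hηs : HasCompactSupport η) {ρ : ℝ} (hρ : ∀ x, η x ≠ 0 → ‖x‖ < ρ) :
    ENNReal.ofReal (‖∫ x, v x * (η x : ℂ)‖ ^ 2) ≤
      eLpNorm v 2 (volume.restrict (Metric.ball 0 ρ)) ^ 2 * ENNReal.ofReal (∫ x, η x ^ 2) := by
  have h1 : ‖∫ x, v x * (η x : ℂ)‖ₑ ≤ ∫⁻ x in Metric.ball 0 ρ, ‖v x‖ₑ * ‖η x‖ₑ := by
    have : ∫ x, v x * (η x : ℂ) = ∫ x in Metric.ball 0 ρ, v x * (η x : ℂ) := by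
      refine (setIntegral_eq_integral_of_forall_compl_eq_zero fun x hx => ?_).symm
      by_contra h
      refine hx (mem_ball_zero_iff.mpr (hρ x fun h0 => h ?_))
      rw [h0, Complex.ofReal_zero, mul_zero]
    rw [this]
    refine (enorm_integral_le_lintegral_enorm _).trans_eq (lintegral_congr fun x => ?_)
    rw [enorm_mul]
    congr 1
    rw [← ofReal_norm, ← ofReal_norm, Complex.norm_real]
  have h2 := ENNReal.lintegral_mul_le_Lp_mul_Lq (volume.restrict (Metric.ball (0 : E n) ρ))
    (Real.HolderConjugate.two_two) (f := fun x => ‖v x‖ₑ) (g := fun x => ‖η x‖ₑ)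
    hv.enorm.aemeasurable hη.enorm.aemeasurable
  have h3 : ‖∫ x, v x * (η x : ℂ)‖ₑ ^ 2 ≤
      (∫⁻ x in Metric.ball 0 ρ, ‖v x‖ₑ ^ (2 : ℝ)) * (∫⁻ x in Metric.ball 0 ρ, ‖η x‖ₑ ^ (2 : ℝ)) := by
    refine (pow_le_pow_left' (h1.trans h2) 2).trans_eq ?_
    rw [mul_pow, sq_rpow_half, sq_rpow_half]
  have hint : Integrable fun x => η x ^ 2 := by
    simp_rw [sq]
    exact (hη.mul hη).integrable_of_hasCompactSupport hηs.mul_right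
  have h5 : ∫⁻ x in Metric.ball 0 ρ, ‖η x‖ₑ ^ (2 : ℝ) ≤ ENNReal.ofReal (∫ x, η x ^ 2) := by
    rw [ofReal_integral_eq_lintegral_ofReal hint
      (Filter.Eventually.of_forall fun x => sq_nonneg _)]
    refine (setLIntegral_le_lintegral _ _).trans_eq (lintegral_congr fun x => ?_)
    rw [Real.enorm_eq_ofReal_abs, ENNReal.ofReal_rpow_of_nonneg (abs_nonneg _) (by norm_num)]
    norm_num
  have h6 : ENNReal.ofReal (‖∫ x, v x * (η x : ℂ)‖ ^ 2) = ‖∫ x, v x * (η x : ℂ)‖ₑ ^ 2 := by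
    rw [ENNReal.ofReal_pow (norm_nonneg _), ofReal_norm]
  rw [h6, sq_eLpNorm_two]
  exact h3.trans (mul_le_mul_right h5 _)

theorem hasCompactSupport_comp_headScale {n k : ℕ} {Φ : E n → ℝ} (hΦs : HasCompactSupport Φ)
    (r : ℝ) (hr : r ≠ 0) : HasCompactSupport fun x => Φ (headScale k r hr x) :=
  hΦs.comp_homeomorph (headScale k r hr).toHomeomorph

/-- The duality argument: superpositions of stretched test functions give lower bounds for the
localized norm of the model function. -/
theorem exists_superposition_bound {n k : ℕ} (hk : 1 ≤ k) (hkn : k < n) {α : ℝ} (hα : 0 ≤ α)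
    (hαk : α < k) :
    ∃ c K : ℝ, 0 < c ∧ 0 < K ∧ ∀ (ρ : ℝ) (m : ℕ) (a r : ℕ → ℝ), (∀ i, 0 ≤ a i) →
      (∀ i, 1 ≤ r i) → (∀ i ∈ Finset.range m, r i ≤ ρ) →
      ENNReal.ofReal ((c * ∑ i ∈ Finset.range m, a i * r i ^ α) ^ 2) ≤
        eLpNorm (invFt fun ξ : E n => (profile k α ξ : ℂ)) 2
          (volume.restrict (Metric.ball 0 ρ)) ^ 2 *
        ENNReal.ofReal (K * ∑ i ∈ Finset.range m, ∑ j ∈ Finset.range m,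
          a i * a j * min (r i ^ k) (r j ^ k)) := by
  obtain ⟨Φ, hΦc, hΦs, hΦ0, hΦ1, c, hc, hpair⟩ := exists_pairing_lower_bound hk hkn hα hαk
  obtain ⟨M, hM⟩ := hΦc.bounded_above_of_compact_support hΦs
  have hM0 : 0 ≤ M := (norm_nonneg _).trans (hM 0)
  have hΦM : ∀ x, Φ x ≤ M := fun x => (le_abs_self _).trans (hM x)
  have hI0 : 0 ≤ ∫ x, Φ x := integral_nonneg hΦ0
  -- The summand `1` makes `K` positive without a lower bound for `∫ Φ`.
  refine ⟨c, M * (∫ x, Φ x) + 1, hc, by positivity, fun ρ m a r ha hr hρ => ?_⟩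
  have hr0 : ∀ i, (r i)⁻¹ ≠ 0 := fun i => inv_ne_zero (by linarith [hr i])
  obtain ⟨Ψ, hΨ⟩ : ∃ Ψ : ℕ → E n → ℝ, ∀ i x, Ψ i x = Φ (headScale k (r i)⁻¹ (hr0 i) x) :=
    ⟨_, fun _ _ => rfl⟩
  have hΨ' : ∀ i, Ψ i = fun x => Φ (headScale k (r i)⁻¹ (hr0 i) x) := fun i => funext (hΨ i)
  have hΨc : ∀ i, Continuous (Ψ i) := fun i => by
    rw [hΨ']
    exact hΦc.comp (headScale k (r i)⁻¹ (hr0 i)).continuous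
  have hΨs : ∀ i, HasCompactSupport (Ψ i) := fun i => by
    rw [hΨ']
    exact hasCompactSupport_comp_headScale hΦs _ _
  have hΨi : ∀ i, Integrable (Ψ i) := fun i => (hΨc i).integrable_of_hasCompactSupport (hΨs i)
  have hΨ0 : ∀ i x, 0 ≤ Ψ i x := fun i x => by rw [hΨ]; exact hΦ0 _
  have hΨM : ∀ i x, Ψ i x ≤ M := fun i x => by rw [hΨ]; exact hΦM _
  have hΨint : ∀ i, ∫ x, Ψ i x = r i ^ k * ∫ x, Φ x := by
    intro i
    have hri : 0 < r i := by linarith [hr i]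
    rw [hΨ', integral_comp_linearEquiv, det_headScale hkn.le, smul_eq_mul, inv_pow, inv_inv,
      abs_of_pos (by positivity)]
  have hΨΨi : ∀ i j, Integrable fun x => Ψ i x * Ψ j x := fun i j =>
    ((hΨc i).mul (hΨc j)).integrable_of_hasCompactSupport (hΨs i).mul_right
  -- Bounding either factor by `M` leaves the integral of the other, whose stretching contributes `r
  -- ^ k`; the better choice gives the minimum.
  have hΨΨ : ∀ i j, ∫ x, Ψ i x * Ψ j x ≤ (M * ∫ x, Φ x) * min (r i ^ k) (r j ^ k) := by
    intro i j
    have h1 : ∫ x, Ψ i x * Ψ j x ≤ (M * ∫ x, Φ x) * r i ^ k := by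
      calc ∫ x, Ψ i x * Ψ j x ≤ ∫ x, Ψ i x * M :=
            integral_mono (hΨΨi i j) ((hΨi i).mul_const M) fun x =>
              mul_le_mul_of_nonneg_left (hΨM j x) (hΨ0 i x)
        _ = _ := by
            rw [integral_mul_const, hΨint]
            ring
    have h2 : ∫ x, Ψ i x * Ψ j x ≤ (M * ∫ x, Φ x) * r j ^ k := by
      calc ∫ x, Ψ i x * Ψ j x ≤ ∫ x, M * Ψ j x :=
            integral_mono (hΨΨi i j) ((hΨi j).const_mul M) fun x =>
              mul_le_mul_of_nonneg_right (hΨM i x) (hΨ0 j x)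
        _ = _ := by
            rw [integral_const_mul, hΨint]
            ring
    rcases le_total (r i ^ k) (r j ^ k) with h | h
    · rwa [min_eq_left h]
    · rwa [min_eq_right h]
  obtain ⟨v, hv⟩ : ∃ v : E n → ℂ, v = invFt fun ξ : E n => (profile k α ξ : ℂ) := ⟨_, rfl⟩
  have hvc : Continuous v := hv ▸ continuous_invFt (integrable_profile hk hkn.le hα hαk)
  rw [← hv] at hpair ⊢
  obtain ⟨η, hη⟩ : ∃ η : E n → ℝ, ∀ x, η x = ∑ i ∈ Finset.range m, a i * Ψ i x := ⟨_, fun _ => rfl⟩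
  have hηc : Continuous η := by
    rw [funext hη]
    exact continuous_finsetSum _ fun i _ => continuous_const.mul (hΨc i)
  have hηρ : ∀ x, η x ≠ 0 → ‖x‖ < ρ := by
    intro x hx
    rw [hη] at hx
    obtain ⟨i, hi, hne⟩ := Finset.exists_ne_zero_of_sum_ne_zero hx
    have h1 := hΦ1 _ (hΨ i x ▸ right_ne_zero_of_mul hne)
    have h2 := norm_le_mul_norm_headScale k (hr i) (hr0 i) x
    have h3 := hρ i hi
    have h4 := hr i
    nlinarith
  have hηs : HasCompactSupport η := by
    refine HasCompactSupport.intro (isCompact_closedBall (0 : E n) ρ) fun x hx => ?_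
    by_contra h
    exact hx (mem_closedBall_zero_iff.mpr (hηρ x h).le)
  have hpairη : c * ∑ i ∈ Finset.range m, a i * r i ^ α ≤ (∫ x, v x * (η x : ℂ)).re := by
    have hvi : ∀ i, Integrable fun x => v x * (Ψ i x : ℂ) := fun i =>
      (hvc.mul (Complex.continuous_ofReal.comp (hΨc i))).integrable_of_hasCompactSupport
        (HasCompactSupport.mul_left ((hΨs i).comp_left Complex.ofReal_zero))
    have h1 : ∫ x, v x * (η x : ℂ) = ∑ i ∈ Finset.range m, (a i : ℂ) * ∫ x, v x * (Ψ i x : ℂ) := by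
      simp_rw [← integral_const_mul]
      rw [← integral_finsetSum _ fun i _ => (hvi i).const_mul _]
      refine integral_congr_ae (Filter.Eventually.of_forall fun x => ?_)
      simp only [hη]
      push_cast
      rw [Finset.mul_sum]
      exact Finset.sum_congr rfl fun i _ => by ring
    rw [h1, Complex.re_sum, Finset.mul_sum]
    refine Finset.sum_le_sum fun i _ => ?_
    rw [Complex.re_ofReal_mul, mul_left_comm]
    refine mul_le_mul_of_nonneg_left ?_ (ha i)
    have := hpair (r i) (hr0 i) (hr i)
    simpa only [hΨ] using this
  have hηsq : ∫ x, η x ^ 2 ≤ (M * (∫ x, Φ x) + 1) * ∑ i ∈ Finset.range m, ∑ j ∈ Finset.range m,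
      a i * a j * min (r i ^ k) (r j ^ k) := by
    have h1 : ∫ x, η x ^ 2 = ∑ i ∈ Finset.range m, ∑ j ∈ Finset.range m,
        a i * a j * ∫ x, Ψ i x * Ψ j x := by
      simp_rw [← integral_const_mul]
      have : ∀ i, ∑ j ∈ Finset.range m, ∫ x, a i * a j * (Ψ i x * Ψ j x) =
          ∫ x, ∑ j ∈ Finset.range m, a i * a j * (Ψ i x * Ψ j x) := fun i =>
        (integral_finsetSum _ fun j _ => (hΨΨi i j).const_mul _).symm
      simp_rw [this]
      rw [← integral_finsetSum _ fun i _ => integrable_finsetSum _ fun j _ =>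
        (hΨΨi i j).const_mul _]
      refine integral_congr_ae (Filter.Eventually.of_forall fun x => ?_)
      simp only [hη]
      rw [sq, Finset.sum_mul_sum]
      exact Finset.sum_congr rfl fun i _ => Finset.sum_congr rfl fun j _ => by ring
    rw [h1]
    simp_rw [Finset.mul_sum]
    refine Finset.sum_le_sum fun i _ => Finset.sum_le_sum fun j _ => ?_
    have haa := mul_nonneg (ha i) (ha j)
    have h2 := hΨΨ i j
    have hmin : 0 ≤ min (r i ^ k) (r j ^ k) :=
      le_min (pow_nonneg (by linarith [hr i]) _) (pow_nonneg (by linarith [hr j]) _)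
    rw [mul_left_comm]
    refine mul_le_mul_of_nonneg_left ?_ haa
    linarith
  refine le_trans (ENNReal.ofReal_le_ofReal ?_)
    ((ofReal_sq_norm_integral_mul_le hvc hηc hηs hηρ).trans
      (mul_le_mul_right (ENNReal.ofReal_le_ofReal hηsq) _))
  have hnn : 0 ≤ c * ∑ i ∈ Finset.range m, a i * r i ^ α :=
    mul_nonneg hc.le (Finset.sum_nonneg fun i _ =>
      mul_nonneg (ha i) (Real.rpow_nonneg (by linarith [hr i]) _))
  exact pow_le_pow_left₀ hnn (hpairη.trans (Complex.re_le_norm _)) 2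

theorem ofReal_div_le_of_le_mul {A B : ℝ} {X : ENNReal} (hB : 0 < B)
    (h : ENNReal.ofReal A ≤ X * ENNReal.ofReal B) : ENNReal.ofReal (A / B) ≤ X := by
  rw [ENNReal.ofReal_div_of_pos hB]
  exact ENNReal.div_le_of_le_mul h

theorem sum_pow_le_pow {q : ℝ} (hq : 2 ≤ q) (m : ℕ) : ∑ i ∈ Finset.range m, q ^ i ≤ q ^ m := by
  induction m with
  | zero => simp
  | succ m ih =>
    rw [Finset.sum_range_succ, pow_succ]
    have : 0 ≤ q ^ m := by positivity
    nlinarith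

/-- Almost orthogonality: the `(i, j)` term is at most `q^{-|i-j|}`. Passing from `m` to `m + 1`
adds a row, a column and a diagonal term, each at most `1`. -/
theorem sum_sum_inv_mul_min_le {q : ℝ} (hq : 2 ≤ q) (m : ℕ) :
    ∑ i ∈ Finset.range m, ∑ j ∈ Finset.range m,
      (q ^ i)⁻¹ * (q ^ j)⁻¹ * min ((q ^ i) ^ 2) ((q ^ j) ^ 2) ≤ 3 * m := by
  have hq0 : 0 < q := by linarith
  have hleft : ∀ i j : ℕ, (q ^ i)⁻¹ * (q ^ j)⁻¹ * min ((q ^ i) ^ 2) ((q ^ j) ^ 2) ≤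
      (q ^ j)⁻¹ * q ^ i := by
    intro i j
    calc _ ≤ (q ^ i)⁻¹ * (q ^ j)⁻¹ * (q ^ i) ^ 2 := by
          gcongr
          exact min_le_left _ _
      _ = _ := by
          field_simp
  have hright : ∀ i j : ℕ, (q ^ i)⁻¹ * (q ^ j)⁻¹ * min ((q ^ i) ^ 2) ((q ^ j) ^ 2) ≤
      (q ^ i)⁻¹ * q ^ j := by
    intro i j
    rw [mul_comm (q ^ i)⁻¹, min_comm]
    exact hleft j i
  have hrow : ∀ m : ℕ, ∑ i ∈ Finset.range m, (q ^ m)⁻¹ * q ^ i ≤ 1 := by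
    intro m
    rw [← Finset.mul_sum, inv_mul_le_one₀ (by positivity)]
    exact sum_pow_le_pow hq m
  induction m with
  | zero => simp
  | succ m ih =>
    rw [Finset.sum_range_succ]
    simp_rw [Finset.sum_range_succ]
    rw [Finset.sum_add_distrib]
    have h1 := (Finset.sum_le_sum fun i (_ : i ∈ Finset.range m) => hleft i m).trans (hrow m)
    have h2 := (Finset.sum_le_sum fun j (_ : j ∈ Finset.range m) => hright m j).trans (hrow m)
    have h3 := hleft m m
    rw [inv_mul_cancel₀ (by positivity)] at h3
    push_cast
    linarith

theorem exists_growth_le_eLpNorm {n k : ℕ} (hk : 1 ≤ k) (hkn : k < n) {α : ℝ}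
    (hα : (k : ℝ) / 2 ≤ α) (hαk : α < k) :
    ∃ c : ℝ, 0 < c ∧ ∀ ρ : ℝ, 1 ≤ ρ → ENNReal.ofReal (c * growth k α ρ) ≤
      eLpNorm (invFt fun ξ : E n => (profile k α ξ : ℂ)) 2
        (volume.restrict (Metric.ball 0 ρ)) ^ 2 := by
  have hα0 : 0 ≤ α := le_trans (by positivity) hα
  obtain ⟨c, K, hc, hK, hb⟩ := exists_superposition_bound hk hkn hα0 hαk
  by_cases hcrit : α = (k : ℝ) / 2
  · have hlog4 : 0 < Real.log 4 := Real.log_pos (by norm_num)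
    refine ⟨c ^ 2 / (3 * K * Real.log 4), by positivity, fun ρ hρ => ?_⟩
    have hρ0 : 0 < ρ := by linarith
    -- The scales `4^0, …, 4^J` all fit below `ρ`, and their number `J + 1` is at least `log₄ ρ`.
    obtain ⟨J, hJ⟩ : ∃ J : ℕ, J = ⌊Real.logb 4 ρ⌋₊ := ⟨_, rfl⟩
    have hlogb : 0 ≤ Real.logb 4 ρ := Real.logb_nonneg (by norm_num) hρ
    have hJ1 : Real.logb 4 ρ ≤ ((J + 1 : ℕ) : ℝ) := by
      rw [hJ]
      push_cast
      exact (Nat.lt_floor_add_one _).le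
    have hJ2 : ∀ i ∈ Finset.range (J + 1), (4 : ℝ) ^ i ≤ ρ := by
      intro i hi
      have h1 : (i : ℝ) ≤ Real.logb 4 ρ := by
        refine le_trans ?_ (Nat.floor_le hlogb)
        rw [← hJ]
        exact_mod_cast Nat.lt_succ_iff.mp (Finset.mem_range.mp hi)
      calc (4 : ℝ) ^ i = 4 ^ (i : ℝ) := (Real.rpow_natCast _ _).symm
        _ ≤ 4 ^ Real.logb 4 ρ := Real.rpow_le_rpow_of_exponent_le (by norm_num) h1
        _ = ρ := Real.rpow_logb (by norm_num) (by norm_num) hρ0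
    have hq : (2 : ℝ) ≤ 2 ^ k := by
      calc (2 : ℝ) = 2 ^ 1 := (pow_one _).symm
        _ ≤ 2 ^ k := pow_le_pow_right₀ (by norm_num) hk
    -- The ratio `4` makes `r_i^{k/2} = (2^k)^i` an integer power, so the double-sum bound applies
    -- with `q = 2^k`.
    have hrk : ∀ i : ℕ, ((4 : ℝ) ^ i) ^ k = (((2 : ℝ) ^ k) ^ i) ^ 2 := by
      intro i
      rw [show (4 : ℝ) = 2 ^ 2 by norm_num, ← pow_mul, ← pow_mul, ← pow_mul, ← pow_mul]
      congr 1
      ring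
    have hrα : ∀ i : ℕ, ((4 : ℝ) ^ i) ^ α = ((2 : ℝ) ^ k) ^ i := by
      intro i
      have : ((4 : ℝ) ^ i) ^ α = (((4 : ℝ) ^ i) ^ k) ^ ((1 : ℝ) / 2) := by
        rw [← Real.rpow_natCast _ k, ← Real.rpow_mul (by positivity), hcrit]
        congr 1
        ring
      rw [this, hrk, ← Real.sqrt_eq_rpow, Real.sqrt_sq (by positivity)]
    -- With weights `r_i^{-k/2}` and `α = k/2` each term of the pairing sum is `1`: the numerator
    -- grows like `(J + 1)²`, the denominator like `J + 1`.
    have h := hb ρ (J + 1) (fun i => (((2 : ℝ) ^ k) ^ i)⁻¹) (fun i => 4 ^ i)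
      (fun i => by positivity) (fun i => one_le_pow₀ (by norm_num)) hJ2
    simp only [hrk, hrα] at h
    have hone : ∀ i : ℕ, (((2 : ℝ) ^ k) ^ i)⁻¹ * ((2 : ℝ) ^ k) ^ i = 1 := fun i =>
      inv_mul_cancel₀ (by positivity)
    simp only [hone, Finset.sum_const, Finset.card_range, nsmul_eq_mul, mul_one] at h
    have hpos : (0 : ℝ) < ((J + 1 : ℕ) : ℝ) := by positivity
    have h' := h.trans (mul_le_mul_right (ENNReal.ofReal_le_ofReal
      (mul_le_mul_of_nonneg_left (sum_sum_inv_mul_min_le hq (J + 1)) hK.le)) _)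
    refine le_trans (ENNReal.ofReal_le_ofReal ?_) (ofReal_div_le_of_le_mul (by positivity) h')
    rw [growth, if_pos hcrit]
    have h3 : (c * ((J + 1 : ℕ) : ℝ)) ^ 2 / (K * (3 * ((J + 1 : ℕ) : ℝ))) =
        c ^ 2 / (3 * K) * ((J + 1 : ℕ) : ℝ) := by
      field_simp
    have h4 : c ^ 2 / (3 * K * Real.log 4) * Real.log ρ = c ^ 2 / (3 * K) * Real.logb 4 ρ := by
      rw [Real.logb]
      field_simp
    rw [h3, h4]
    gcongr
  · refine ⟨c ^ 2 / K, by positivity, fun ρ hρ => ?_⟩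
    have hρ0 : 0 < ρ := by linarith
    -- Above the critical exponent the largest scale alone suffices: `ρ^{2α} / ρ^k`.
    have h := hb ρ 1 (fun _ => 1) (fun _ => ρ) (fun _ => zero_le_one) (fun _ => hρ)
      (fun _ _ => le_rfl)
    simp only [Finset.range_one, Finset.sum_singleton, one_mul, min_self] at h
    refine le_trans (ENNReal.ofReal_le_ofReal ?_) (ofReal_div_le_of_le_mul (by positivity) h)
    rw [growth, if_neg hcrit, Real.rpow_sub hρ0, Real.rpow_natCast, mul_comm 2 α,
      Real.rpow_mul hρ0.le]
    refine le_of_eq ?_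
    norm_cast
    field_simp

/-! ### Scaling and rotation of the model function -/

theorem map_smul_isometry {n : ℕ} (T : E n ≃ₗᵢ[ℝ] E n) {t : ℝ} (ht : 0 < t) :
    Measure.map (fun x => t • T x) (volume : Measure (E n)) =
      ENNReal.ofReal (t ^ n)⁻¹ • volume := by
  have h1 : (fun x => t • T x) = (fun x : E n => t • x) ∘ T := rfl
  rw [h1, ← Measure.map_map (measurable_const_smul t) T.continuous.measurable,
    T.measurePreserving.map_eq, Measure.map_addHaar_smul _ ht.ne', finrank_euclideanSpace_fin,
    abs_of_pos (by positivity)]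

theorem setLIntegral_comp_smul_isometry {n : ℕ} (T : E n ≃ₗᵢ[ℝ] E n) {t : ℝ} (ht : 0 < t)
    {F : E n → ENNReal} (hF : Measurable F) {s : Set (E n)} (hs : MeasurableSet s) :
    ∫⁻ x in (fun x => t • T x) ⁻¹' s, F (t • T x) = ENNReal.ofReal (t ^ n)⁻¹ * ∫⁻ x in s, F x := by
  have hm : Measurable fun x => t • T x := (T.continuous.const_smul t).measurable
  rw [← setLIntegral_map hs hF hm, map_smul_isometry T ht, Measure.restrict_smul,
    lintegral_smul_measure, smul_eq_mul]

theorem invFt_comp_smul_isometry {n : ℕ} (T : E n ≃ₗᵢ[ℝ] E n) {t : ℝ} (ht : 0 < t) (a : ℂ)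
    (U : E n → ℂ) (x : E n) :
    invFt (fun ξ => a * U (t⁻¹ • T ξ)) x = a * (t : ℂ) ^ n * invFt U (t • T x) := by
  obtain ⟨G, hG⟩ : ∃ G : E n → ℂ, ∀ ζ, G ζ =
      Complex.exp (Complex.I * ((inner ℝ (t • T x) ζ : ℝ) : ℂ)) * U ζ := ⟨_, fun _ => rfl⟩
  have h1 : ∀ ξ, Complex.exp (Complex.I * ((inner ℝ x ξ : ℝ) : ℂ)) * (a * U (t⁻¹ • T ξ)) =
      a * G (t⁻¹ • T ξ) := by
    intro ξ
    rw [hG, inner_smul_left, inner_smul_right, T.inner_map_map]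
    simp only [conj_trivial]
    rw [mul_inv_cancel_left₀ ht.ne']
    ring
  have h2 : ∫ ξ, G (t⁻¹ • T ξ) = ∫ ζ, G (t⁻¹ • ζ) :=
    T.measurePreserving.integral_comp T.toHomeomorph.measurableEmbedding fun ζ => G (t⁻¹ • ζ)
  rw [invFt, integral_congr_ae (Filter.Eventually.of_forall h1), integral_const_mul, h2,
    Measure.integral_comp_inv_smul_of_nonneg _ _ ht.le, finrank_euclideanSpace_fin, invFt,
    Complex.real_smul]
  simp only [hG]
  push_cast
  ring

/-- The powers of `t` from `|ξ|^α` and from the symbol cancel, and the bump is radial, so `T`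
survives only in the symbol. -/
theorem profile_smul_isometry {n k : ℕ} (α : ℝ) (T : E n ≃ₗᵢ[ℝ] E n) {t : ℝ} (ht : 0 < t)
    (ξ : E n) :
    profile k α (t⁻¹ • T ξ) = ‖ξ‖ ^ α * annulusBump (t⁻¹ • ξ) / headSymb k α (T ξ) := by
  have hb : annulusBump (t⁻¹ • T ξ) = annulusBump (t⁻¹ • ξ) := by
    rw [annulusBump, annulusBump, norm_smul, norm_smul, T.norm_map]
  have hti : 0 < t⁻¹ := by positivity
  rw [profile, hb, headSymb_smul k α hti.le, norm_smul, T.norm_map, Real.norm_of_nonneg hti.le,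
    Real.mul_rpow hti.le (norm_nonneg _), mul_assoc,
    mul_div_mul_left _ _ (Real.rpow_pos_of_pos hti α).ne']

theorem exists_schwartz_ft_eq_annulusBump (n : ℕ) {t : ℝ} (ht : 0 < t) :
    ∃ f : 𝓢(E n, ℂ), ∀ ξ, ft f ξ = ((t ^ (-(n : ℝ) / 2) * annulusBump (t⁻¹ • ξ) : ℝ) : ℂ) := by
  have hs : HasCompactSupport fun ξ : E n => t ^ (-(n : ℝ) / 2) * annulusBump (t⁻¹ • ξ) :=
    HasCompactSupport.mul_left ((hasCompactSupport_annulusBump n).comp_smul (inv_ne_zero ht.ne'))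
  obtain ⟨ψ, hψ⟩ := exists_schwartz_ofReal
    (contDiff_const.mul ((contDiff_annulusBump n).comp (contDiff_const_smul t⁻¹))) hs
  obtain ⟨f, hf⟩ := exists_ft_eq_schwartz ψ
  exact ⟨f, fun ξ => (hf ξ).trans (hψ ξ)⟩

/-- The squared prefactor `t^n` cancels the Jacobian of the dilation. -/
theorem sq_eLpNorm_smul_comp_isometry {n : ℕ} (T : E n ≃ₗᵢ[ℝ] E n) {t : ℝ} (ht : 0 < t)
    {v : E n → ℂ} (hv : Continuous v) (R : ℝ) :
    eLpNorm (fun x => ((t ^ (-(n : ℝ) / 2) : ℝ) : ℂ) * (t : ℂ) ^ n * v (t • T x)) 2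
        (volume.restrict (Metric.ball 0 R)) ^ 2 =
      eLpNorm v 2 (volume.restrict (Metric.ball 0 (R * t))) ^ 2 := by
  have hball : Metric.ball (0 : E n) R = (fun x => t • T x) ⁻¹' Metric.ball 0 (R * t) := by
    ext x
    rw [Set.mem_preimage, mem_ball_zero_iff, mem_ball_zero_iff, norm_smul, T.norm_map,
      Real.norm_of_nonneg ht.le, mul_comm R, mul_lt_mul_iff_right₀ ht]
  have hm : Measurable fun x => ‖v x‖ₑ ^ (2 : ℝ) := hv.enorm.measurable.pow_const _
  have hc : ‖((t ^ (-(n : ℝ) / 2) : ℝ) : ℂ) * (t : ℂ) ^ n‖ₑ ^ (2 : ℝ) = ENNReal.ofReal (t ^ n) := by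
    rw [← Complex.ofReal_pow, ← Complex.ofReal_mul, ← ofReal_norm, Complex.norm_real,
      Real.norm_of_nonneg (by positivity), ENNReal.ofReal_rpow_of_nonneg (by positivity)
      (by norm_num), ← Real.rpow_natCast t n, ← Real.rpow_add ht, ← Real.rpow_mul ht.le]
    congr 2
    ring
  rw [sq_eLpNorm_two, sq_eLpNorm_two]
  simp_rw [enorm_mul _ (v _), ENNReal.mul_rpow_of_nonneg _ _ (zero_le_two (α := ℝ)), hc]
  rw [lintegral_const_mul' _ _ ENNReal.ofReal_ne_top, hball,
    setLIntegral_comp_smul_isometry T ht hm measurableSet_ball, ← mul_assoc,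
    ← ENNReal.ofReal_mul (by positivity), mul_inv_cancel₀ (by positivity), ENNReal.ofReal_one,
    one_mul]

theorem sq_eLpNorm_fracLaplacian_rieszPot {n k : ℕ} (hk : 1 ≤ k) (hkn : k ≤ n) {α : ℝ}
    (hα : 0 ≤ α) (hαk : α < k) {t : ℝ} (ht : 0 < t) {f : 𝓢(E n, ℂ)}
    (hf : ∀ ξ, ft f ξ = ((t ^ (-(n : ℝ) / 2) * annulusBump (t⁻¹ • ξ) : ℝ) : ℂ)) (Q : SO n)
    (R : ℝ) :
    eLpNorm (fracLaplacian α fun x => rieszPot k α f x Q) 2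
        (volume.restrict (Metric.ball 0 R)) ^ 2 =
      eLpNorm (invFt fun ξ : E n => (profile k α ξ : ℂ)) 2
        (volume.restrict (Metric.ball 0 (R * t))) ^ 2 := by
  obtain ⟨ψ, hψ⟩ : ∃ ψ : E n → ℝ, ψ = fun ξ => t ^ (-(n : ℝ) / 2) * annulusBump (t⁻¹ • ξ) :=
    ⟨_, rfl⟩
  have hψc : Continuous ψ := by
    rw [hψ]
    exact continuous_const.mul ((contDiff_annulusBump n).continuous.comp (continuous_const_smul _))
  have hψs : HasCompactSupport ψ := by
    rw [hψ]
    exact HasCompactSupport.mul_left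
      ((hasCompactSupport_annulusBump n).comp_smul (inv_ne_zero ht.ne'))
  have hfψ : ∀ ξ, ft f ξ = (ψ ξ : ℂ) := fun ξ => by rw [hf, hψ]
  have hU : Integrable fun ξ => ft f ξ / (symb k α ξ Q : ℂ) := by
    simp_rw [hfψ]
    exact integrable_div_symb hk hkn hα hαk Q (Complex.continuous_ofReal.comp hψc)
      (hψs.comp_left Complex.ofReal_zero)
  have hU' : Integrable fun ξ => ((‖ξ‖ ^ α : ℝ) : ℂ) * (ft f ξ / (symb k α ξ Q : ℂ)) := by
    simp_rw [hfψ, ← mul_div_assoc]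
    refine integrable_div_symb hk hkn hα hαk Q ?_ ?_
    · exact (Complex.continuous_ofReal.comp (continuous_norm.rpow_const fun _ => Or.inr hα)).mul
        (Complex.continuous_ofReal.comp hψc)
    · exact HasCompactSupport.mul_left (hψs.comp_left Complex.ofReal_zero)
  have hae := fracLaplacian_invFt α hU hU'
  have hprof : (fun ξ => ((‖ξ‖ ^ α : ℝ) : ℂ) * (ft f ξ / (symb k α ξ Q : ℂ))) =
      fun ξ => ((t ^ (-(n : ℝ) / 2) : ℝ) : ℂ) *
        (fun ζ => (profile k α ζ : ℂ)) (t⁻¹ • rotCoord Q ξ) := by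
    ext ξ
    simp only
    rw [hf, profile_smul_isometry α _ ht, symb_eq_headSymb]
    push_cast
    ring
  rw [hprof, funext (invFt_comp_smul_isometry (rotCoord Q) ht _
    fun ζ => (profile k α ζ : ℂ))] at hae
  rw [← sq_eLpNorm_smul_comp_isometry (rotCoord Q) ht
    (continuous_invFt (integrable_profile hk hkn hα hαk))]
  exact congrArg (· ^ 2) (eLpNorm_congr_ae (ae_restrict_of_ae hae))

theorem haarSO_univ (n : ℕ) : haarSO n Set.univ = 1 := by
  have h := Measure.haarMeasure_self (K₀ := (⊤ : TopologicalSpace.PositiveCompacts (SO n)))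
  rwa [TopologicalSpace.PositiveCompacts.coe_top] at h

/-! ### Sobolev norms of the model functions -/

/-- The square of the homogeneous Sobolev norm of the model function. -/
def sobolevSq (n : ℕ) (s : ℝ) : ENNReal :=
  ∫⁻ ξ : E n, ENNReal.ofReal (‖ξ‖ ^ (2 * s) * annulusBump ξ ^ 2)

theorem measurable_sobolevSq_integrand (n : ℕ) (s : ℝ) :
    Measurable fun ξ : E n => ENNReal.ofReal (‖ξ‖ ^ (2 * s) * annulusBump ξ ^ 2) :=
  ((measurable_norm.pow_const _).mul
    ((contDiff_annulusBump n).continuous.measurable.pow_const 2)).ennreal_ofReal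

/-- The bump lives away from the origin, so `|ξ|^{2s}` is bounded on its support for either sign of
`s`; the sum of the two endpoint values covers both signs. -/
theorem sobolevSq_lt_top (n : ℕ) (s : ℝ) : sobolevSq n s < ⊤ := by
  have hle : ∀ ξ : E n, ENNReal.ofReal (‖ξ‖ ^ (2 * s) * annulusBump ξ ^ 2) ≤
      (Metric.closedBall (0 : E n) 3).indicator
        (fun _ => ENNReal.ofReal ((1 / 2) ^ s + (9 / 2) ^ s)) ξ := by
    intro ξ
    by_cases h : annulusBump ξ = 0
    · simp [h]
    obtain ⟨h1, h2⟩ := annulusBump_ne_zero h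
    have hmem : ξ ∈ Metric.closedBall (0 : E n) 3 := by
      rw [mem_closedBall_zero_iff]
      nlinarith [norm_nonneg ξ]
    rw [Set.indicator_of_mem hmem]
    refine ENNReal.ofReal_le_ofReal ?_
    have hb : annulusBump ξ ^ 2 ≤ 1 := pow_le_one₀ (annulusBump_nonneg ξ) (annulusBump_le_one ξ)
    have hp : ‖ξ‖ ^ (2 * s) = (‖ξ‖ ^ 2) ^ s := by
      rw [Real.rpow_mul (norm_nonneg _)]
      norm_num
    have hb1 : ‖ξ‖ ^ (2 * s) ≤ (1 / 2) ^ s + (9 / 2) ^ s := by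
      rw [hp]
      have p1 : (0 : ℝ) ≤ (1 / 2) ^ s := by positivity
      have p2 : (0 : ℝ) ≤ (9 / 2) ^ s := by positivity
      rcases le_total 0 s with hs | hs
      · have := Real.rpow_le_rpow (by positivity) h2.le hs
        linarith
      · have := Real.rpow_le_rpow_of_nonpos (by norm_num) h1.le hs
        linarith
    exact (mul_le_of_le_one_right (Real.rpow_nonneg (norm_nonneg _) _) hb).trans hb1
  refine lt_of_le_of_lt (lintegral_mono hle) ?_
  rw [lintegral_indicator measurableSet_closedBall, setLIntegral_const]
  exact ENNReal.mul_lt_top ENNReal.ofReal_lt_top measure_closedBall_lt_top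

theorem sobolevSq_pos {n : ℕ} (hn : 2 ≤ n) (s : ℝ) : 0 < sobolevSq n s := by
  rw [sobolevSq, lintegral_pos_iff_support (measurable_sobolevSq_integrand n s)]
  -- `goodRegion n 1` serves only as a nonempty open set on which the bump equals `1`; it is
  -- nonempty because `n ≥ 2`.
  refine lt_of_lt_of_le ((isOpen_goodRegion n 1).measure_pos _
    (goodRegion_nonempty le_rfl (by omega))) (measure_mono fun ζ hζ => ?_)
  obtain ⟨h1, h2, h3⟩ := hζ
  have hsum := headSq_add_tailSq 1 ζ
  have hn1 : 1 < ‖ζ‖ ^ 2 := by linarith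
  have hn0 : 0 < ‖ζ‖ := by
    refine (norm_nonneg ζ).lt_of_ne fun h => ?_
    rw [← h] at hn1
    norm_num at hn1
  rw [Function.mem_support, annulusBump_eq_one hn1.le h3.le]
  refine (ENNReal.ofReal_pos.mpr ?_).ne'
  positivity

theorem hDotNorm_eq {n : ℕ} {t : ℝ} (ht : 0 < t) {f : 𝓢(E n, ℂ)}
    (hf : ∀ ξ, ft f ξ = ((t ^ (-(n : ℝ) / 2) * annulusBump (t⁻¹ • ξ) : ℝ) : ℂ)) (s : ℝ) :
    hDotNorm s f = ENNReal.ofReal ((sobolevSq n s).toReal ^ (1 / 2 : ℝ) * t ^ s) := by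
  have hti : 0 < t⁻¹ := by positivity
  have h1 : ∀ ξ : E n, ENNReal.ofReal (‖ξ‖ ^ (2 * s) * ‖ft f ξ‖ ^ 2) =
      ENNReal.ofReal (t ^ (2 * s) * (t⁻¹ ^ n)) * (fun ζ : E n => ENNReal.ofReal
        (‖ζ‖ ^ (2 * s) * annulusBump ζ ^ 2)) (t⁻¹ • (LinearIsometryEquiv.refl ℝ (E n)) ξ) := by
    intro ξ
    simp only [LinearIsometryEquiv.coe_refl, id_eq]
    rw [← ENNReal.ofReal_mul (by positivity), hf, Complex.norm_real,
      Real.norm_of_nonneg (mul_nonneg (by positivity) (annulusBump_nonneg _)), norm_smul,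
      Real.norm_of_nonneg hti.le, Real.mul_rpow hti.le (norm_nonneg _), Real.inv_rpow ht.le]
    have h2 : (t ^ (-(n : ℝ) / 2)) ^ 2 = t⁻¹ ^ n := by
      rw [← Real.rpow_natCast, ← Real.rpow_mul ht.le, inv_pow, ← Real.rpow_natCast t n,
        ← Real.rpow_neg ht.le]
      congr 1
      push_cast
      ring
    have h3 : t ^ (2 * s) ≠ 0 := (Real.rpow_pos_of_pos ht _).ne'
    rw [mul_pow, h2]
    congr 1
    field_simp
  have h2 := setLIntegral_comp_smul_isometry (LinearIsometryEquiv.refl ℝ (E n)) hti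
    (measurable_sobolevSq_integrand n s) MeasurableSet.univ
  rw [Set.preimage_univ, Measure.restrict_univ] at h2
  rw [hDotNorm, lintegral_congr h1, lintegral_const_mul' _ _ ENNReal.ofReal_ne_top, h2,
    ← mul_assoc, ← ENNReal.ofReal_mul (by positivity), mul_assoc,
    mul_inv_cancel₀ (by positivity), mul_one]
  change (ENNReal.ofReal (t ^ (2 * s)) * sobolevSq n s) ^ (1 / 2 : ℝ) = _
  rw [← ENNReal.ofReal_toReal (sobolevSq_lt_top n s).ne, ← ENNReal.ofReal_mul (by positivity),
    ENNReal.ofReal_rpow_of_nonneg (by positivity) (by norm_num),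
    ENNReal.toReal_ofReal ENNReal.toReal_nonneg,
    Real.mul_rpow (by positivity) ENNReal.toReal_nonneg, ← Real.rpow_mul ht.le, mul_comm]
  congr 3
  ring

end RotSmooth

end

/-! ### Assembly of the theorem. -/

theorem theoremB (n : ℕ) (hn : 2 ≤ n) (k : ℕ) (hk : 1 ≤ k) (hkn : k ≤ n - 1)
    (α : ℝ) (hα : (k : ℝ) / 2 ≤ α) (hαk : α < k) :
    ∃ c : ℝ, 0 < c ∧ ∃ A B : ℝ → ℝ, (∀ s, 0 < A s) ∧ (∀ s, 0 < B s) ∧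
      ∀ R : ℝ, 0 < R → ∃ f : ℕ → 𝓢(RotSmooth.E n, ℂ),
        (∀ N : ℕ, 1 ≤ N → ∀ s : ℝ,
          ENNReal.ofReal (A s * (N : ℝ) ^ s) ≤ RotSmooth.hDotNorm s (f N) ∧
          RotSmooth.hDotNorm s (f N) ≤ ENNReal.ofReal (B s * (N : ℝ) ^ s)) ∧
        (∀ N : ℕ, Real.pi / (2 * R) < N →
          ENNReal.ofReal (c * RotSmooth.growth k α (R * N)) ≤
            RotSmooth.localAverage k α R (f N)) := by
  have hkn' : k < n := by omega
  have hα0 : 0 ≤ α := le_trans (by positivity) hα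
  obtain ⟨c, hc, hb⟩ := RotSmooth.exists_growth_le_eLpNorm hk hkn' hα hαk
  have hpos : ∀ s, 0 < (RotSmooth.sobolevSq n s).toReal ^ (1 / 2 : ℝ) := fun s =>
    Real.rpow_pos_of_pos (ENNReal.toReal_pos (RotSmooth.sobolevSq_pos hn s).ne'
      (RotSmooth.sobolevSq_lt_top n s).ne) _
  have hex : ∀ N : ℕ, ∃ f : 𝓢(RotSmooth.E n, ℂ), 1 ≤ N → ∀ ξ, RotSmooth.ft f ξ =
      (((N : ℝ) ^ (-(n : ℝ) / 2) * RotSmooth.annulusBump ((N : ℝ)⁻¹ • ξ) : ℝ) : ℂ) := by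
    intro N
    by_cases hN : 1 ≤ N
    · obtain ⟨f, hf⟩ := RotSmooth.exists_schwartz_ft_eq_annulusBump n
        (t := (N : ℝ)) (by exact_mod_cast hN)
      exact ⟨f, fun _ => hf⟩
    -- At `N = 0` nothing is claimed, since `N > π / (2R)` already forces `N ≥ 1`.
    · exact ⟨0, fun h => absurd h hN⟩
  choose f hf using hex
  -- The Sobolev norm is known exactly, so `A = B`.
  refine ⟨c, hc, _, _, hpos, hpos, fun R hR => ⟨f, fun N hN s => ?_, fun N hN => ?_⟩⟩
  · have hN0 : (0 : ℝ) < N := by exact_mod_cast hN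
    rw [RotSmooth.hDotNorm_eq hN0 (hf N hN) s]
    exact ⟨le_rfl, le_rfl⟩
  · have hpi := Real.pi_gt_three
    have hN0 : (0 : ℝ) < N := lt_trans (by positivity) hN
    have hN1 : 1 ≤ N := by exact_mod_cast hN0
    -- The condition on `N` says `R N > π/2`, which exceeds `1`.
    have hρ : 1 ≤ R * N := by
      rw [div_lt_iff₀ (by positivity)] at hN
      linarith
    simp only [RotSmooth.localAverage, RotSmooth.sq_eLpNorm_fracLaplacian_rieszPot hk hkn'.le hα0
      hαk hN0 (hf N hN1)]
    -- The integrand no longer depends on `Q`, so only the total mass `1` of the Haar measure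
    -- enters.
    rw [lintegral_const, RotSmooth.haarSO_univ, mul_one]
    exact hb _ hρ
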